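/- Let $E$ be a complex elliptic curve, and let $\mathcal N,\mathcal N'$ be line bundles on $E$ with $2\le \deg\mathcal N\le\deg\mathcal N'$. Let $\mathcal E\cong\mathcal N\oplus\mathcal N'$ and let $\overline s=(s,s')\in H^0(\mathcal N)\oplus H^0(\mathcal N')\cong H^0(\mathcal E)$ be a global section of $\mathcal E$. Then the annihilator $\{\varphi\in\operatorname{End}(\mathcal E) : \varphi(\overline s)=0\}$ of $\overline s$ in $\operatorname{End}(\mathcal E)$ is zero if and only if $s\ne 0$, $s'\ne 0$, and the zero divisor of $s$ is not contained in that of $s'$, counting multiplicities: it is not the case that $\operatorname{ord}_x(s)\le\operatorname{ord}_x(s')$ for all points $x\in E$. -/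

import Mathlib

open CategoryTheory CategoryTheory.Limits AlgebraicGeometry

/-- A (complex) elliptic curve, in the language of algebraic geometry: an integral scheme, proper
over `ℂ`, nonsingular of dimension one (the local ring at each closed point is a regular local
ring of dimension one, that is, a discrete valuation ring), which carries a structure of group
scheme over `ℂ`. In other words, a one-dimensional abelian variety over `ℂ`. -/
class IsComplexEllipticCurve (E : Over (Spec (.of ℂ))) : Prop where
  isProper : IsProper E.hom
  isIntegral : IsIntegral E.left
  isDiscreteValuationRing : ∀ x : E.left, IsClosed ({x} : Set E.left) →
    IsDiscreteValuationRing (E.left.presheaf.stalk x)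
  nonempty_grpObj : Nonempty (GrpObj E)

instance (E : Over (Spec (.of ℂ))) [IsComplexEllipticCurve E] : IsIntegral E.left :=
  IsComplexEllipticCurve.isIntegral

instance (E : Over (Spec (.of ℂ))) [IsComplexEllipticCurve E] :
    IsLocallyNoetherian E.left :=
  have := IsComplexEllipticCurve.isProper (E := E)
  LocallyOfFiniteType.isLocallyNoetherian E.hom

namespace LineBundle

variable {X : Scheme.{0}}

/-- The restriction of a section of an `𝒪_X`-module to a smaller open set. -/
noncomputable def res {M : X.Modules} {U V : X.Opens} (h : V ≤ U) (s : Γ(M, U)) : Γ(M, V) :=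
  M.presheaf.map (homOfLE h).op s

/-- A section `e` of `M` over `U` is a frame (a nowhere vanishing section, when `M` is a line
bundle) if multiplication by `e` is an isomorphism `𝒪_U ≅ M|_U`. -/
def IsFrame {M : X.Modules} {U : X.Opens} (e : Γ(M, U)) : Prop :=
  ∀ (V : X.Opens) (h : V ≤ U), Function.Bijective (fun a : Γ(X, V) ↦ a • res h e)

/-- A line bundle (invertible sheaf): an `𝒪_X`-module that is locally isomorphic to `𝒪_X`. -/
def IsLineBundle (M : X.Modules) : Prop :=
  ∀ x : X, ∃ (U : X.Opens) (e : Γ(M, U)), x ∈ U ∧ IsFrame e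

variable [IsIntegral X] [IsLocallyNoetherian X]

/-- `n` is the order at `x` of the rational section of `M` given by the section `t` over the
open set `U` (the point `x` need not lie in `U`): there is a frame `e` of `M` near `x` such that
`t = f • e` for a rational function `f` whose order of vanishing at `x` is `n`. -/
def HasOrder {M : X.Modules} {U : X.Opens} (t : Γ(M, U)) (x : X) (n : ℤ) : Prop :=
  ∃ (V : X.Opens) (e : Γ(M, V)) (W : X.Opens) (hU : W ≤ U) (hV : W ≤ V) (_ : Nonempty W)
    (a : Γ(X, W)), x ∈ V ∧ IsFrame e ∧ res hU t = a • res hV e ∧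
      n = Scheme.ord (X.germToFunctionField W a) x

open Classical in
/-- The order at `x` of the rational section of the line bundle `M` given by `t`. It does not
depend on the frame, and it is `0` at all points that are not of codimension one. -/
noncomputable def order {M : X.Modules} {U : X.Opens} (t : Γ(M, U)) (x : X) : ℤ :=
  if h : ∃ n, HasOrder t x n then h.choose else 0

/-- The zero divisor `(s)₀`, with multiplicities, of a nonzero global section of a line bundle,
given by its coefficient at each point. -/
noncomputable def zeroDivisor {M : X.Modules} (s : Γ(M, ⊤)) : X → ℤ :=
  fun x ↦ order s x

open Classical in
/-- The degree of a line bundle on a nonsingular complete curve over `ℂ` (so that all closed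
points have degree one): the degree of the divisor of a nonzero rational section. -/
noncomputable def degree (M : X.Modules) : ℤ :=
  if h : ∃ p : (Σ U : X.Opens, Γ(M, U)), p.2 ≠ 0 then ∑ᶠ x : X, order h.choose.2 x else 0

end LineBundle

/-- The annihilator in the ring `End(ℰ)` of a global section of an `𝒪_X`-module `ℰ`, for the
left action of `End(ℰ)` on `H⁰(ℰ)`: a left ideal. -/
def sectionAnnihilator {X : Scheme.{0}} {ℰ : X.Modules} (s : Γ(ℰ, ⊤)) : Ideal (End ℰ) where
  carrier := {φ | Scheme.Modules.Hom.app φ ⊤ s = 0}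
  zero_mem' := rfl
  add_mem' {φ ψ} hφ hψ := by
    change (Scheme.Modules.Hom.app (M := ℰ) (N := ℰ) φ ⊤) s +
      (Scheme.Modules.Hom.app (M := ℰ) (N := ℰ) ψ ⊤) s = 0
    rw [hφ, hψ, add_zero]
  smul_mem' φ ψ hψ := by
    change (Scheme.Modules.Hom.app (M := ℰ) (N := ℰ) φ ⊤)
      ((Scheme.Modules.Hom.app (M := ℰ) (N := ℰ) ψ ⊤) s) = 0
    rw [hψ, map_zero]

/-!
A section `σ = (s, s')` of `N ⊞ N'` is killed by an endomorphism exactly when both rows of the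
matrix of the endomorphism are relations: homomorphisms `a : N ⟶ P`, `b : N' ⟶ P` with
`a s + b s' = 0`, where `P` is `N` or `N'`. So the annihilator of `σ` vanishes if and only if there
are no nontrivial relations (`sectionAnnihilator_eq_bot_of_hom`,
`hom_eq_zero_of_sectionAnnihilator_eq_bot`).

A nonzero homomorphism of line bundles is injective on sections and does not decrease the order of
vanishing anywhere (`IsLineBundle.hom_eq_zero`, `IsLineBundle.order_le_order_app`). If `b ≠ 0` in
a relation with values in `N'`, then `b s'` has at least the divisor of `s'` and the same degree,
hence the same divisor (`IsLineBundle.order_eq_of_le`), while `b s' = -a s` has at least the divisor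
of `s`; so the divisor of `s` is contained in that of `s'`. If `a ≠ 0` in a relation with values in
`N`, the same argument shows that `a s = -b s'` has the divisor of `s`, and since
`deg N ≤ deg N'` also that of `s'`, so the two divisors agree. Conversely, if the divisor of `s` is
contained in that of `s'`, then the quotient `s' / s` is a regular homomorphism `N ⟶ N'` which takes
`s` to `s'` (`IsLineBundle.exists_hom`), and this gives a relation; if `s` or `s'` is zero, an
identity map gives one.

Comparing the degrees needs the fact that the degree of a line bundle can be computed with any
nonzero section, that is, that principal divisors on a complete nonsingular curve have degree zero
(`AlgebraicGeometry.Scheme.finsum_ord`). For a nonconstant function `f` in the function field `K`,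
let `A` be the integral closure of `k[f]` in `K`. By the valuative criteria of properness and
separatedness, the closed points where `f` vanishes correspond to the primes of `A` above `f`, and
the order of `f` there is the ramification index. All residue fields are `k`, so `f` has
`[K : k(f)]` zeros with multiplicities (`IsCompleteFamily.finsum_zeros`). The poles of `f` are the
zeros of `f⁻¹`, and `k(f⁻¹) = k(f)`.
-/

/-! ### Valuations of discrete valuation rings -/

theorem Ring.ord_ringEquiv {R S : Type*} [CommRing R] [CommRing S] (e : R ≃+* S) (x : R) :
    Ring.ord S (e x) = Ring.ord R x := by
  unfold Ring.ord
  rw [Module.length_quotient, Module.length_quotient,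
    ← Order.coheight_orderIso e.symm.idealComapOrderIso (Ideal.span {x})]
  congr 1
  change Ideal.span {e x} = Ideal.comap e.symm (Ideal.span {x})
  rw [Ideal.comap_symm, Ideal.map_span, Set.image_singleton]

/-- A local domain between a Dedekind domain `A` and its fraction field `K` which is centred at a
prime `q` of `A` is the localization of `A` at `q`: the latter is a valuation ring. -/
theorem IsDedekindDomain.isLocalization_atPrime_comap (A R K : Type*) [CommRing A]
    [IsDedekindDomain A] [CommRing R] [IsLocalRing R] [Field K] [Algebra A R] [Algebra R K]
    [Algebra A K] [IsScalarTower A R K] [IsFractionRing A K]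
    (hRK : Function.Injective (algebraMap R K)) (q : Ideal A) [q.IsPrime]
    (hq : q = (IsLocalRing.maximalIdeal R).comap (algebraMap A R)) :
    IsLocalization.AtPrime R q := by
  have hmem : ∀ a : A, a ∉ q ↔ IsUnit (algebraMap A R a) := fun a ↦ by
    rw [hq, Ideal.mem_comap, IsLocalRing.mem_maximalIdeal, mem_nonunits_iff, not_not]
  have hAR : Function.Injective (algebraMap A R) := by
    have := IsFractionRing.injective A K
    rw [IsScalarTower.algebraMap_eq A R K] at this
    exact Function.Injective.of_comp this
  refine ⟨?_, ?_, ?_⟩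
  · rintro ⟨a, ha⟩
    exact (hmem a).1 ha
  · intro z
    let Q := Localization.AtPrime q
    have hle : q.primeCompl ≤ nonZeroDivisors A := q.primeCompl_le_nonZeroDivisors
    let : Algebra Q K := (IsLocalization.lift (M := q.primeCompl) (g := algebraMap A K)
      (fun s ↦ IsLocalization.map_units K ⟨s.1, hle s.2⟩)).toAlgebra
    have : IsScalarTower A Q K := IsScalarTower.of_algebraMap_eq fun a ↦
      (IsLocalization.lift_eq _ a).symm
    have : IsFractionRing Q K :=
      IsFractionRing.isFractionRing_of_isDomain_of_isLocalization q.primeCompl Q K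
    have : ValuationRing Q := inferInstance
    rcases ValuationRing.isInteger_or_isInteger Q (algebraMap R K z) with ⟨y, hy⟩ | ⟨y, hy⟩
    · obtain ⟨⟨a, s⟩, has⟩ := IsLocalization.surj q.primeCompl y
      refine ⟨⟨a, s⟩, hRK ?_⟩
      rw [map_mul, ← hy, ← IsScalarTower.algebraMap_apply, ← IsScalarTower.algebraMap_apply]
      rw [IsScalarTower.algebraMap_apply A Q K, IsScalarTower.algebraMap_apply A Q K, ← map_mul,
        has]
    · obtain ⟨⟨a, s⟩, has⟩ := IsLocalization.surj q.primeCompl y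
      have h1 : (algebraMap R K z)⁻¹ * algebraMap A K s = algebraMap A K a := by
        rw [← hy, IsScalarTower.algebraMap_apply A Q K, IsScalarTower.algebraMap_apply A Q K,
          ← map_mul, has]
      by_cases hz : z = 0
      · exact ⟨⟨0, 1⟩, by simp [hz]⟩
      have hz' : algebraMap R K z ≠ 0 := fun h ↦ hz (hRK (by rw [h, map_zero]))
      have h2 : algebraMap A R s = z * algebraMap A R a := by
        apply hRK
        rw [map_mul, ← IsScalarTower.algebraMap_apply, ← IsScalarTower.algebraMap_apply, ← h1,
          mul_inv_cancel_left₀ hz']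
      -- `z⁻¹ = a / s` with `s` a unit of `R`, so that `a` is a unit of `R` as well
      have hs : IsUnit (z * algebraMap A R a) := h2 ▸ (hmem s).1 s.2
      have ha : a ∉ q := (hmem a).2 (isUnit_of_mul_isUnit_right hs)
      exact ⟨⟨s, ⟨a, ha⟩⟩, h2.symm⟩
  · intro x y h
    exact ⟨1, by simpa using hAR h⟩

/-- The normalized valuation of an element of the fraction field of a discrete valuation ring. -/
noncomputable def dvrOrd (R : Type*) [CommRing R] [IsDomain R] [IsDiscreteValuationRing R]
    {K : Type*} [Field K] [Algebra R K] [IsFractionRing R K] (f : K) : ℤ :=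
  WithZero.log (Ring.ordFrac R f)

section dvrOrd

variable (R : Type*) [CommRing R] [IsDomain R] [IsDiscreteValuationRing R]
  {K : Type*} [Field K] [Algebra R K] [IsFractionRing R K]

theorem dvrOrd_inv (f : K) : dvrOrd R f⁻¹ = - dvrOrd R f := by
  simp [dvrOrd]

theorem dvrOrd_algebraMap {x : R} (hx : x ≠ 0) :
    dvrOrd R (algebraMap R K x) = (Ring.ord R x).toNat := by
  obtain ⟨n, hn⟩ := ENat.ne_top_iff_exists.mp
    (Ring.ord_ne_top (mem_nonZeroDivisors_of_ne_zero hx))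
  rw [dvrOrd, Ring.ordFrac_eq_ord R hx,
    Ring.ordMonoidWithZeroHom_eq_coe _ (mem_nonZeroDivisors_of_ne_zero hx) hn.symm, ← hn]
  simp [WithZero.log]

theorem dvrOrd_algebraMap_nonneg (x : R) : 0 ≤ dvrOrd R (algebraMap R K x) := by
  by_cases hx : x = 0
  · simp [hx, dvrOrd]
  · rw [dvrOrd_algebraMap R hx]; positivity

theorem dvrOrd_algebraMap_pos {x : R} (hx : x ≠ 0) :
    0 < dvrOrd R (algebraMap R K x) ↔ ¬ IsUnit x := by
  have h : dvrOrd R (algebraMap R K x) = 0 ↔ IsUnit x := by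
    rw [Ring.isUnit_iff_ordFrac_one_of_isDiscreteValuationRing (K := K), dvrOrd]
    have h0 : Ring.ordFrac R (algebraMap R K x) ≠ 0 := (map_ne_zero _).2 (by simpa using hx)
    rw [← WithZero.exp_inj, WithZero.exp_log h0, WithZero.exp_zero]
  have := dvrOrd_algebraMap_nonneg R (K := K) x
  rw [← h]
  omega

/-- An element of positive order lies in the maximal ideal. -/
theorem exists_of_dvrOrd_pos {f : K} (hf : 0 < dvrOrd R f) :
    ∃ x : R, algebraMap R K x = f ∧ x ≠ 0 ∧ ¬ IsUnit x := by
  have hf0 : f ≠ 0 := by rintro rfl; simp [dvrOrd] at hf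
  obtain ⟨x, hx⟩ : IsLocalization.IsInteger R f := by
    refine (ValuationRing.isInteger_or_isInteger R f).resolve_right ?_
    rintro ⟨y, hy⟩
    have := dvrOrd_algebraMap_nonneg R (K := K) y
    rw [hy, dvrOrd_inv] at this
    omega
  have hx0 : x ≠ 0 := by rintro rfl; simp at hx; exact hf0 hx.symm
  exact ⟨x, hx, hx0, (dvrOrd_algebraMap_pos R (K := K) hx0).1 (hx ▸ hf)⟩

end dvrOrd

/-! ### Principal divisors in a function field of one variable -/

/-- An integral domain which is integral over a quotient ring of an algebraically closed field has
degree one over it. -/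
theorem IsAlgClosed.finrank_eq_one_of_surjective {k F B : Type*} [Field k] [IsAlgClosed k]
    [CommRing F] [Nontrivial F] [CommRing B] [IsDomain B] [Algebra k F] [Algebra F B]
    [Algebra.IsIntegral F B] (h : Function.Surjective (algebraMap k F)) :
    Module.finrank F B = 1 := by
  let := ((algebraMap F B).comp (algebraMap k F)).toAlgebra
  have htow : IsScalarTower k F B := IsScalarTower.of_algebraMap_eq' rfl
  have : Algebra.IsIntegral k F :=
    ⟨fun x ↦ by obtain ⟨c, rfl⟩ := h x; exact isIntegral_algebraMap⟩
  have : Algebra.IsIntegral k B := Algebra.IsIntegral.trans F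
  have hb := IsAlgClosed.algebraMap_bijective_of_isIntegral (k := k) (K := B)
  have hF : Function.Bijective (algebraMap F B) := by
    refine ⟨fun x y hxy ↦ ?_, fun y ↦ ?_⟩
    · obtain ⟨a, rfl⟩ := h x
      obtain ⟨b, rfl⟩ := h y
      exact congrArg _ (hb.1 hxy)
    · obtain ⟨a, rfl⟩ := hb.2 y
      exact ⟨_, rfl⟩
  rw [← (LinearEquiv.ofBijective (Algebra.linearMap F B) hF).finrank_eq, Module.finrank_self]

section Adjoin

variable {k K : Type*} [Field k] [Field K] [Algebra k K] {f : K}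

theorem Transcendental.isPrincipalIdealRing_adjoin (hf : Transcendental k f) :
    IsPrincipalIdealRing (Algebra.adjoin k {f}) :=
  IsPrincipalIdealRing.of_surjective
    (Polynomial.algEquivOfTranscendental k f hf : Polynomial k →+* Algebra.adjoin k {f})
    (Polynomial.algEquivOfTranscendental k f hf).surjective

/-- The origin of the affine line `Spec k[f]`. -/
noncomputable def originIdeal (k : Type*) {K : Type*} [Field k] [Field K] [Algebra k K] (f : K) :
    Ideal (Algebra.adjoin k {f}) :=
  Ideal.span {⟨f, Algebra.self_mem_adjoin_singleton k f⟩}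

theorem algebraMap_quotient_originIdeal_surjective :
    Function.Surjective (algebraMap k (Algebra.adjoin k {f} ⧸ originIdeal k f)) := by
  intro y
  obtain ⟨⟨x, hx⟩, rfl⟩ := Ideal.Quotient.mk_surjective y
  induction hx using Algebra.adjoin_induction with
  | mem x hx =>
    obtain rfl := hx
    refine ⟨0, ?_⟩
    rw [map_zero, eq_comm, Ideal.Quotient.eq_zero_iff_mem]
    exact Ideal.mem_span_singleton_self _
  | algebraMap r => exact ⟨r, rfl⟩
  | add x y hx hy h1 h2 =>
    obtain ⟨a, ha⟩ := h1
    obtain ⟨b, hb⟩ := h2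
    exact ⟨a + b, by rw [map_add, ha, hb, ← map_add]; rfl⟩
  | mul x y hx hy h1 h2 =>
    obtain ⟨a, ha⟩ := h1
    obtain ⟨b, hb⟩ := h2
    exact ⟨a * b, by rw [map_mul, ha, hb, ← map_mul]; rfl⟩

theorem Transcendental.isMaximal_originIdeal (hf : Transcendental k f) :
    (originIdeal k f).IsMaximal := by
  have := hf.isPrincipalIdealRing_adjoin
  have : Irreducible (⟨f, Algebra.self_mem_adjoin_singleton k f⟩ : Algebra.adjoin k {f}) := by
    have h := (MulEquiv.irreducible_iff (Polynomial.algEquivOfTranscendental k f hf)).2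
      (Polynomial.irreducible_X (R := k))
    convert h
    simp
  exact PrincipalIdealRing.isMaximal_of_irreducible this

/-- Over an algebraically closed field, all points above the origin are rational. -/
theorem Transcendental.inertiaDeg_originIdeal [IsAlgClosed k] (hf : Transcendental k f)
    {A : Type*} [CommRing A] [Algebra (Algebra.adjoin k {f}) A]
    [Algebra.IsIntegral (Algebra.adjoin k {f}) A] (q : Ideal A) [q.IsMaximal]
    [q.LiesOver (originIdeal k f)] :
    q.inertiaDeg (Algebra.adjoin k {f}) = 1 := by
  have := hf.isMaximal_originIdeal
  rw [Ideal.inertiaDeg_eq_of_isMaximal (originIdeal k f) q]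
  exact IsAlgClosed.finrank_eq_one_of_surjective (k := k)
    algebraMap_quotient_originIdeal_surjective

end Adjoin

/-- A family of discrete valuation rings of `K / k` is complete if its members are distinct as
subrings of `K` and every valuation ring of `K / k` contains one of them: these are the local rings
at the closed points of a complete nonsingular model of `K`. -/
structure IsCompleteFamily (k K : Type*) [Field k] [Field K] [Algebra k K] {ι : Type*}
    (R : ι → Type*) [∀ i, CommRing (R i)] [∀ i, Algebra (R i) K] : Prop where
  algebraMap_mem : ∀ i c, algebraMap k K c ∈ (algebraMap (R i) K).range
  eq_of_range_eq : ∀ i j, (algebraMap (R i) K).range = (algebraMap (R j) K).range → i = j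
  exists_le : ∀ V : ValuationSubring K, (∀ c, algebraMap k K c ∈ V) →
    ∃ i, ∀ x : R i, algebraMap (R i) K x ∈ V

/-- A ring homomorphism whose values lie in the range of an injective one factors through it. -/
theorem RingHom.exists_factor_of_injective {A R K : Type*} [CommRing A] [CommRing R] [CommRing K]
    (f : A →+* K) (g : R →+* K) (hg : Function.Injective g) (h : ∀ a, f a ∈ g.range) :
    ∃ φ : A →+* R, ∀ a, g (φ a) = f a := by
  choose φ hφ using h
  refine ⟨⟨⟨⟨φ, hg ?_⟩, fun x y ↦ hg ?_⟩, hg ?_, fun x y ↦ hg ?_⟩, hφ⟩ <;> simp [hφ]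

section Sum

variable {k K ι : Type*} [Field k] [Field K] [Algebra k K] {R : ι → Type*}
  [∀ i, CommRing (R i)] [∀ i, IsDomain (R i)] [∀ i, IsDiscreteValuationRing (R i)]
  [∀ i, Algebra (R i) K] [∀ i, IsFractionRing (R i) K] {f : K}

open IntermediateField IntermediateField.algebraAdjoinAdjoin

/-- A discrete valuation ring of `K / k` containing `f` contains the integral closure of `k[f]`. -/
theorem IsCompleteFamily.exists_integralClosure_hom (hR : IsCompleteFamily k K R) {i : ι}
    (hi : 0 < dvrOrd (R i) f) :
    ∃ φ : integralClosure (Algebra.adjoin k {f}) K →+* R i,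
      ∀ a, algebraMap (R i) K (φ a) = (a : K) := by
  have hinj : Function.Injective (algebraMap (R i) K) := IsFractionRing.injective _ _
  obtain ⟨ψ, hψ⟩ := RingHom.exists_factor_of_injective
    (algebraMap (Algebra.adjoin k {f}) K) (algebraMap (R i) K) hinj (by
      let S : Subalgebra k K := { (algebraMap (R i) K).range with
        algebraMap_mem' := hR.algebraMap_mem i }
      have : Algebra.adjoin k {f} ≤ S := by
        rw [Algebra.adjoin_le_iff, Set.singleton_subset_iff]
        obtain ⟨x, hx, -⟩ := exists_of_dvrOrd_pos (R i) hi
        exact ⟨x, hx⟩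
      exact fun b ↦ this b.2)
  refine RingHom.exists_factor_of_injective
    (algebraMap (integralClosure (Algebra.adjoin k {f}) K) K) _ hinj fun a ↦ ?_
  let := ψ.toAlgebra
  have : IsScalarTower (Algebra.adjoin k {f}) (R i) K :=
    IsScalarTower.of_algebraMap_eq fun b ↦ (hψ b).symm
  have h : IsIntegral (R i) (a : K) := IsIntegral.tower_top (R := Algebra.adjoin k {f}) a.2
  obtain ⟨y, hy⟩ := IsIntegrallyClosed.isIntegral_iff.1 h
  exact ⟨y, hy⟩

/-- Every nonzero prime of a Dedekind model of `K / k` is the centre of a member of a complete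
family. -/
theorem IsCompleteFamily.exists_dvrOrd_pos (hR : IsCompleteFamily k K R) {A : Type*} [CommRing A]
    [IsDedekindDomain A] [Algebra A K] [IsFractionRing A K]
    (hk : ∀ c, algebraMap k K c ∈ (algebraMap A K).range) {P : Ideal A} [hP : P.IsPrime]
    (hP0 : P ≠ ⊥) :
    ∃ i, ∀ a ∈ P, a ≠ 0 → 0 < dvrOrd (R i) (algebraMap A K a) := by
  let v : IsDedekindDomain.HeightOneSpectrum A := ⟨P, hP, hP0⟩
  let V := (v.valuation K).valuationSubring
  have hA0 : ∀ a : A, a ≠ 0 → algebraMap A K a ≠ 0 := fun a ha ↦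
    (map_ne_zero_iff _ (IsFractionRing.injective A K)).2 ha
  have hAV : ∀ a : A, algebraMap A K a ∈ V := fun a ↦ v.valuation_le_one a
  have hPV : ∀ a ∈ P, a ≠ 0 → (algebraMap A K a)⁻¹ ∉ V := fun a ha ha0 h ↦ by
    have h1 := (v.valuation_lt_one_iff_mem (K := K) a).2 ha
    have h2 : v.valuation K (algebraMap A K a)⁻¹ ≤ 1 := h
    have h3 : v.valuation K (algebraMap A K a) * v.valuation K (algebraMap A K a)⁻¹ = 1 := by
      rw [← map_mul, mul_inv_cancel₀ (hA0 a ha0), map_one]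
    exact (mul_lt_one_of_lt_of_le h1 h2).ne h3
  obtain ⟨i, hi⟩ := hR.exists_le V
    (fun c ↦ by obtain ⟨a, ha⟩ := hk c; exact ha ▸ hAV a)
  refine ⟨i, fun a ha ha0 ↦ ?_⟩
  by_contra h
  rcases ValuationRing.isInteger_or_isInteger (R i) (algebraMap A K a) with ⟨y, hy⟩ | ⟨y, hy⟩
  · have hy0 : y ≠ 0 := by rintro rfl; exact hA0 a ha0 (by rw [← hy, map_zero])
    rw [← hy, dvrOrd_algebraMap_pos (R i) hy0, not_not] at h
    obtain ⟨u, rfl⟩ := h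
    have h4 := hi ↑u⁻¹
    rw [map_units_inv, hy] at h4
    exact hPV a ha ha0 h4
  · have h4 := hi y
    rw [hy] at h4
    exact hPV a ha ha0 h4

/-- The order of the generator `b` of a prime of `B` at a prime `q` of `A` above it is the
ramification index of `q`, both being the length of `A_q / b`. -/
theorem dvrOrd_eq_ramificationIdx {R K B A : Type*} [CommRing R] [IsDomain R]
    [IsDiscreteValuationRing R] [Field K] [Algebra R K] [IsFractionRing R K]
    [CommRing A] [CommRing B] [Algebra B A] [Algebra A R] (q : Ideal A) [q.IsPrime]
    [IsLocalization.AtPrime R q] (b : B) [q.LiesOver (Ideal.span {b})]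
    (hb : algebraMap A R (algebraMap B A b) ≠ 0) :
    dvrOrd R (algebraMap R K (algebraMap A R (algebraMap B A b))) = q.ramificationIdx B := by
  rw [dvrOrd_algebraMap R hb, Ideal.ramificationIdx_eq (Ideal.span {b}) q]
  congr 2
  let e := IsLocalization.algEquiv q.primeCompl (Localization.AtPrime q) R
  have h : algebraMap A R (algebraMap B A b) =
      e.toRingEquiv (algebraMap A (Localization.AtPrime q) (algebraMap B A b)) := by
    simp [e]
  rw [h, Ring.ord_ringEquiv, Ring.ord, Ideal.map_span, Set.image_singleton,
    ← IsScalarTower.algebraMap_apply]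

set_option maxHeartbeats 1000000 in
/-- A function on a complete curve has as many zeros, with multiplicities, as the degree of the
function field over the subfield which the function generates. -/
theorem IsCompleteFamily.finsum_zeros [IsAlgClosed k] [CharZero k] (hR : IsCompleteFamily k K R)
    (hf : Transcendental k f) [FiniteDimensional k⟮f⟯ K] :
    {i | 0 < dvrOrd (R i) f}.Finite ∧
      ∑ᶠ i : {i | 0 < dvrOrd (R i) f}, dvrOrd (R i) f = Module.finrank k⟮f⟯ K := by
  let B := Algebra.adjoin k {f}
  let A := integralClosure B K
  have hPID : IsPrincipalIdealRing B := hf.isPrincipalIdealRing_adjoin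
  have hsep : Algebra.IsSeparable k⟮f⟯ K := inferInstance
  have hfrac : IsFractionRing A K := integralClosure.isFractionRing_of_finite_extension k⟮f⟯ K
  have hDed : IsDedekindDomain A := integralClosure.isDedekindDomain B k⟮f⟯ K
  have hfin : Module.Finite B A := IsIntegralClosure.finite B k⟮f⟯ K A
  let p : Ideal B := originIdeal k f
  have hp : p.IsMaximal := hf.isMaximal_originIdeal
  have hf0 : f ≠ 0 := by rintro rfl; exact hf isAlgebraic_zero
  let b : B := ⟨f, Algebra.self_mem_adjoin_singleton k f⟩
  have hb0 : algebraMap B A b ≠ 0 := fun h ↦ hf0 (congrArg (algebraMap A K) h)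
  have hbf : algebraMap A K (algebraMap B A b) = f := rfl
  have hprimes : (p.primesOver A).Finite := IsDedekindDomain.primesOver_finite p A
  have : Fintype (p.primesOver A) := hprimes.fintype
  have hflat : Module.Flat B A := inferInstance
  have hsum := Ideal.sum_ramification_inertia_eq_finrank p A
  rw [← IsFractionRing.finrank_eq B k⟮f⟯ A K] at hsum
  -- the zeros `i` of `f`, and the primes `q i` of `A` which are their centres
  let J := {i | 0 < dvrOrd (R i) f}
  choose φ hφ using fun i : J ↦ hR.exists_integralClosure_hom i.2
  let q : J → Ideal A := fun i ↦ (IsLocalRing.maximalIdeal (R i)).comap (φ i)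
  have hφf : ∀ i : J, algebraMap (R i) K (φ i (algebraMap B A b)) = f := fun i ↦ hφ i _
  have hqf : ∀ i, algebraMap B A b ∈ q i := fun i ↦ by
    obtain ⟨x, hx, -, hx'⟩ := exists_of_dvrOrd_pos (R i) i.2
    have : φ i (algebraMap B A b) = x :=
      IsFractionRing.injective (R i) K ((hφf i).trans hx.symm)
    change φ i (algebraMap B A b) ∈ IsLocalRing.maximalIdeal (R i)
    rwa [this, IsLocalRing.mem_maximalIdeal]
  have hqp : ∀ i, (q i).IsPrime := fun i ↦ Ideal.comap_isPrime _ _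
  have hqo : ∀ i, (q i).LiesOver p := fun i ↦ by
    refine ⟨hp.eq_of_le (Ideal.IsPrime.ne_top inferInstance) ?_⟩
    rw [show p = Ideal.span {b} from rfl, Ideal.span_singleton_le_iff_mem]
    exact hqf i
  have hloc : ∀ i : J, letI := (φ i).toAlgebra; IsLocalization.AtPrime (R i) (q i) := fun i ↦ by
    let := (φ i).toAlgebra
    have : IsScalarTower A (R i) K := IsScalarTower.of_algebraMap_eq fun a ↦ (hφ i a).symm
    exact IsDedekindDomain.isLocalization_atPrime_comap A (R i) K
      (IsFractionRing.injective _ _) (q i) rfl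
  let Q : J → p.primesOver A := fun i ↦ ⟨q i, hqp i, hqo i⟩
  have hord : ∀ i : J, dvrOrd (R i) f = (Q i).1.ramificationIdx B := fun i ↦ by
    let := (φ i).toAlgebra
    have := hloc i
    have : (q i).LiesOver (Ideal.span {b}) := hqo i
    have h0 : algebraMap A (R i) (algebraMap B A b) ≠ 0 := by
      intro h
      apply hf0
      rw [← hφf i, show φ i (algebraMap B A b) = 0 from h, map_zero]
    rw [← dvrOrd_eq_ramificationIdx (K := K) (q i) b h0, RingHom.algebraMap_toAlgebra, hφf i]
  have hmaxq : ∀ P : Ideal A, P.IsPrime → algebraMap B A b ∈ P → P.IsMaximal := fun P hP hbP ↦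
    hP.isMaximal (by rintro rfl; exact hb0 hbP)
  -- `R i` is the localization of `A` at `q i`, hence determined by `q i` as a subring of `K`
  have hinj : Function.Injective Q := by
    intro i j hij
    have hq : q i = q j := congrArg Subtype.val hij
    have key : ∀ i j : J, q i = q j →
        (algebraMap (R i) K).range ≤ (algebraMap (R j) K).range := by
      rintro i j hq _ ⟨x, rfl⟩
      let := (φ i).toAlgebra
      have := hloc i
      obtain ⟨⟨a, s⟩, has⟩ := IsLocalization.surj (q i).primeCompl x
      have hs : IsUnit (φ j s) := by
        by_contra h
        exact s.2 (hq.ge (show (s : A) ∈ q j from h))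
      obtain ⟨u, hu⟩ := hs
      refine ⟨φ j a * ↑u⁻¹, ?_⟩
      have hs0 : algebraMap (R j) K u ≠ 0 := by
        rw [hu, hφ j]
        intro h0
        apply s.2
        have : (s : A) = 0 := Subtype.ext h0
        rw [this]; exact (q i).zero_mem
      have h1 : algebraMap (R i) K x * (s : A) = (a : K) := by
        rw [← hφ i, ← hφ i, ← map_mul]
        exact congrArg _ has
      apply mul_right_cancel₀ hs0
      rw [← map_mul, mul_assoc, Units.inv_mul, mul_one, hu, hφ, hφ, h1]
    exact Subtype.ext (hR.eq_of_range_eq _ _ (le_antisymm (key i j hq) (key j i hq.symm)))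
  -- the localization of `A` at a prime above `p` contains a member of the complete family
  have hsurj : Function.Surjective Q := by
    rintro ⟨P, hP, hPo⟩
    have hbP : algebraMap B A b ∈ P := by
      have : b ∈ P.under B := hPo.over ▸ Ideal.mem_span_singleton_self b
      exact this
    have hP0 : P ≠ ⊥ := by rintro rfl; exact hb0 hbP
    obtain ⟨i, hpos⟩ := hR.exists_dvrOrd_pos (A := A)
      (fun c ↦ ⟨algebraMap B A (algebraMap k B c), rfl⟩) hP0
    have hi := hpos (algebraMap B A b) hbP hb0
    rw [hbf] at hi
    obtain ⟨j, rfl⟩ : ∃ j : J, j.1 = i := ⟨⟨i, hi⟩, rfl⟩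
    have hPq : P ≤ q j := fun a ha ↦ by
      by_cases ha0 : a = 0
      · rw [ha0]; exact Ideal.zero_mem _
      obtain ⟨x, hx, -, hx'⟩ := exists_of_dvrOrd_pos (R j) (hpos a ha ha0)
      have : φ j a = x := IsFractionRing.injective (R j) K ((hφ j a).trans hx.symm)
      change φ j a ∈ IsLocalRing.maximalIdeal (R j)
      rwa [this, IsLocalRing.mem_maximalIdeal]
    exact ⟨j, Subtype.ext ((hmaxq P hP hbP).eq_of_le (hqp j).ne_top hPq).symm⟩
  have hbij : Function.Bijective Q := ⟨hinj, hsurj⟩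
  have hJ : Finite J := Finite.of_injective Q hinj
  refine ⟨hJ, ?_⟩
  have : Fintype J := Fintype.ofFinite J
  rw [← hsum, finsum_eq_sum_of_fintype, Nat.cast_sum]
  refine Fintype.sum_bijective Q hbij _ _ fun i ↦ ?_
  have : (Q i).1.IsMaximal := hmaxq _ (hqp i) (hqf i)
  have : (Q i).1.LiesOver (originIdeal k f) := hqo i
  rw [hf.inertiaDeg_originIdeal (Q i).1, mul_one, hord i]

end Sum

section Sum

variable {k K ι : Type*} [Field k] [Field K] [Algebra k K] {R : ι → Type*}
  [∀ i, CommRing (R i)] [∀ i, IsDomain (R i)] [∀ i, IsDiscreteValuationRing (R i)]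
  [∀ i, Algebra (R i) K] [∀ i, IsFractionRing (R i) K]

open IntermediateField

/-- Constants have no zeros and no poles. -/
theorem IsCompleteFamily.dvrOrd_algebraMap_base (hR : IsCompleteFamily k K R) (c : k) (i : ι) :
    dvrOrd (R i) (algebraMap k K c) = 0 := by
  have h : ∀ c : k, 0 ≤ dvrOrd (R i) (algebraMap k K c) := fun c ↦ by
    obtain ⟨x, hx⟩ := hR.algebraMap_mem i c
    rw [← hx]
    exact dvrOrd_algebraMap_nonneg _ x
  have h1 := h c⁻¹
  rw [map_inv₀, dvrOrd_inv] at h1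
  have := h c
  omega

/-- The divisor of a function on a complete curve has degree zero: `f` and `f⁻¹` generate the same
subfield, hence have equally many zeros. -/
theorem IsCompleteFamily.finsum_dvrOrd [IsAlgClosed k] [CharZero k] (hR : IsCompleteFamily k K R)
    (hK : ∀ g : K, Transcendental k g → FiniteDimensional k⟮g⟯ K) (f : K) :
    {i | dvrOrd (R i) f ≠ 0}.Finite ∧ ∑ᶠ i, dvrOrd (R i) f = 0 := by
  by_cases hf : Transcendental k f
  · have hf' : Transcendental k f⁻¹ := fun h ↦ hf (by simpa using h.inv)
    have := hK f hf
    have := hK _ hf'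
    obtain ⟨h1, h2⟩ := hR.finsum_zeros hf
    obtain ⟨h3, h4⟩ := hR.finsum_zeros hf'
    have hfield : k⟮f⁻¹⟯ = k⟮f⟯ := by
      apply le_antisymm <;> rw [adjoin_simple_le_iff]
      · exact inv_mem (mem_adjoin_simple_self k f)
      · simpa using inv_mem (mem_adjoin_simple_self k f⁻¹)
    rw [hfield, ← h2,
      finsum_set_coe_eq_finsum_mem (s := {i | 0 < dvrOrd (R i) f}) (f := fun i ↦ dvrOrd (R i) f),
      finsum_set_coe_eq_finsum_mem (s := {i | 0 < dvrOrd (R i) f⁻¹})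
        (f := fun i ↦ dvrOrd (R i) f⁻¹)] at h4
    simp only [dvrOrd_inv] at h3 h4
    have hfin : {i | dvrOrd (R i) f ≠ 0}.Finite := (h1.union h3).subset fun i hi ↦ by
      simp only [Set.mem_ofPred_eq, Set.mem_union] at hi ⊢
      omega
    refine ⟨hfin, ?_⟩
    rw [finsum_mem_neg_distrib _ h3] at h4
    rw [← finsum_mem_support, show (Function.support fun i ↦ dvrOrd (R i) f) =
      {i | 0 < dvrOrd (R i) f} ∪ {i | 0 < - dvrOrd (R i) f} by
        ext i
        simp only [Function.mem_support, Set.mem_ofPred_eq, Set.mem_union]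
        omega, finsum_mem_union _ h1 h3]
    · omega
    · rw [Set.disjoint_left]
      intro i hi hi'
      simp only [Set.mem_ofPred_eq] at hi hi'
      omega
  · -- algebraic elements are constants
    rw [Transcendental, not_not] at hf
    have := adjoin.finiteDimensional hf.isIntegral
    obtain ⟨c, hc⟩ := (IsAlgClosed.algebraMap_bijective_of_isIntegral (k := k) (K := k⟮f⟯)).2
      (AdjoinSimple.gen k f)
    obtain rfl : algebraMap k K c = f := congrArg Subtype.val hc
    simp [hR.dvrOrd_algebraMap_base]

end Sum

/-! ### Function fields of affine curves -/

/-- A domain whose localizations at the maximal ideals are discrete valuation rings has dimension at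
most one. -/
theorem Ring.DimensionLEOne.of_isDiscreteValuationRing {B : Type*} [CommRing B] [IsDomain B]
    (h : ∀ m : Ideal B, ∀ [m.IsMaximal], ∃ (R : Type) (_ : CommRing R) (_ : IsDomain R)
      (_ : Algebra B R), IsLocalization.AtPrime R m ∧ IsDiscreteValuationRing R) :
    Ring.DimensionLEOne B := by
  refine ⟨fun {q} hq0 hq ↦ ?_⟩
  obtain ⟨m, hm, hqm⟩ := q.exists_le_maximal hq.ne_top
  obtain ⟨R, _, _, _, hloc, hR⟩ := h m
  have hdisj : Disjoint (m.primeCompl : Set B) (q : Set B) :=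
    Set.disjoint_left.2 fun x hx hx' ↦ hx (hqm hx')
  have hqR : (q.map (algebraMap B R)).IsPrime :=
    IsLocalization.isPrime_of_isPrime_disjoint m.primeCompl R q hq hdisj
  have hcm : (q.map (algebraMap B R)).under B = q :=
    IsLocalization.under_map_of_isPrime_disjoint m.primeCompl R hq hdisj
  have hqR0 : q.map (algebraMap B R) ≠ ⊥ := by
    intro h0
    rw [h0] at hcm
    apply hq0
    rw [← hcm, Ideal.under, ← RingHom.ker_eq_comap_bot, RingHom.ker_eq_bot_iff_eq_zero]
    exact fun x hx ↦ (IsLocalization.injective R m.primeCompl_le_nonZeroDivisors)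
      (hx.trans (map_zero _).symm)
  have hqm' := IsLocalRing.eq_maximalIdeal (hqR.isMaximal hqR0)
  rw [hqm', IsLocalization.AtPrime.under_maximalIdeal R m] at hcm
  exact hcm ▸ hm

/-- A domain over which a domain of dimension at most one is integral has dimension at most one, by
lying over. -/
theorem Ring.DimensionLEOne.of_injective_isIntegral {C B : Type*} [CommRing C] [IsDomain C]
    [CommRing B] [IsDomain B] [Algebra C B] [Algebra.IsIntegral C B]
    (hinj : Function.Injective (algebraMap C B)) [Ring.DimensionLEOne B] :
    Ring.DimensionLEOne C := by
  refine ⟨fun {p} hp0 hp ↦ ?_⟩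
  obtain ⟨q, -, hq, hqp⟩ := Ideal.exists_ideal_over_prime_of_isIntegral p (⊥ : Ideal B) (by
    rw [← RingHom.ker_eq_comap_bot, (RingHom.injective_iff_ker_eq_bot _).1 hinj]
    exact bot_le)
  have hq0 : q ≠ ⊥ := by
    rintro rfl
    rw [← RingHom.ker_eq_comap_bot, (RingHom.injective_iff_ker_eq_bot _).1 hinj] at hqp
    exact hp0 hqp.symm
  have := hq.isMaximal hq0
  rw [← hqp]
  exact Ideal.isMaximal_comap_of_isIntegral_of_isMaximal q

open IntermediateField Cardinal

/-- The function field of an affine curve has transcendence degree at most one. -/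
theorem Algebra.trdeg_le_one_of_dimensionLEOne (k B K : Type*) [Field k] [CommRing B] [IsDomain B]
    [Algebra k B] [Algebra.FiniteType k B] [Ring.DimensionLEOne B] [Field K] [Algebra B K]
    [IsFractionRing B K] [Algebra k K] [IsScalarTower k B K] :
    Algebra.trdeg k K ≤ 1 := by
  -- Noether normalization: `B` is integral over a polynomial ring, whose dimension bounds `s`
  obtain ⟨s, g, hg, hint⟩ := exists_integral_inj_algHom_of_fg k B
  let := g.toRingHom.toAlgebra
  have : IsScalarTower k (MvPolynomial (Fin s) k) B := IsScalarTower.of_algebraMap_eq'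
    g.comp_algebraMap.symm
  have : Algebra.IsIntegral (MvPolynomial (Fin s) k) B := ⟨hint⟩
  have hdim : Ring.DimensionLEOne (MvPolynomial (Fin s) k) :=
    Ring.DimensionLEOne.of_injective_isIntegral (B := B) hg
  have hs : s ≤ 1 := by
    have h1 : Ring.KrullDimLE 1 (MvPolynomial (Fin s) k) := inferInstance
    rw [Ring.krullDimLE_iff, MvPolynomial.ringKrullDim_of_isNoetherianRing] at h1
    simpa [ringKrullDim_eq_zero_of_field] using h1
  have halgB : Algebra.IsAlgebraic (MvPolynomial (Fin s) k) B := inferInstance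
  have hC : Algebra.trdeg k (MvPolynomial (Fin s) k) = s := by
    rw [MvPolynomial.trdeg_of_isDomain]; simp
  have : FaithfulSMul (MvPolynomial (Fin s) k) B :=
    (faithfulSMul_iff_algebraMap_injective _ _).2 hg
  have h1 := lift_trdeg_add_eq k (MvPolynomial (Fin s) k) B
  have : Algebra.IsAlgebraic B K :=
    IsLocalization.isAlgebraic K (nonZeroDivisors B)
  have : FaithfulSMul k B := inferInstance
  have h2 := lift_trdeg_add_eq k B K
  simp only [trdeg_eq_zero, lift_zero, add_zero] at h1 h2
  rw [hC, lift_natCast, eq_comm, lift_eq_nat_iff] at h1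
  rw [h1, lift_natCast, eq_comm, lift_eq_nat_iff] at h2
  rw [h2]
  exact_mod_cast hs

/-- The function field of an affine curve is finite over the subfield generated by any nonconstant
function. -/
theorem Transcendental.finiteDimensional_adjoin {k B K : Type*} [Field k] [CommRing B] [IsDomain B]
    [Algebra k B] [Algebra.FiniteType k B] [Ring.DimensionLEOne B] [Field K] [Algebra B K]
    [IsFractionRing B K] [Algebra k K] [IsScalarTower k B K] {f : K} (hf : Transcendental k f) :
    FiniteDimensional k⟮f⟯ K := by
  have hind : AlgebraicIndependent k ![f] := by
    exact algebraicIndependent_unique_type_iff.2 hf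
  have hbasis := hind.isTranscendenceBasis_of_lift_trdeg_le_of_finite (by
    simpa using Algebra.trdeg_le_one_of_dimensionLEOne k B K)
  have halg := hbasis.isAlgebraic_field
  have hr : Set.range ![f] = {f} := by simp
  rw [hr] at halg
  have : Algebra.EssFiniteType k B := inferInstance
  have : Algebra.EssFiniteType B K := .of_isLocalization _ (nonZeroDivisors B)
  have : Algebra.EssFiniteType k K := .comp k B K
  have : Algebra.EssFiniteType k⟮f⟯ K := .of_comp k k⟮f⟯ K
  exact Algebra.finite_of_essFiniteType_of_isAlgebraic

/-! ### Local rings of a complete curve -/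

namespace AlgebraicGeometry.Scheme

variable {X : Scheme.{0}} {k : Type} [Field k] (π : X ⟶ Spec (.of k))

/-- The homomorphism from the base field to the local ring of a `k`-scheme at a point. -/
noncomputable def stalkStructureMap (x : X) : CommRingCat.of k ⟶ X.presheaf.stalk x :=
  Spec.preimage (X.fromSpecStalk x ≫ π)

theorem SpecMap_stalkStructureMap (x : X) :
    Spec.map (stalkStructureMap π x) = X.fromSpecStalk x ≫ π :=
  Spec.map_preimage _

theorem stalkStructureMap_comp_stalkSpecializes {x y : X} (h : x ⤳ y) :
    stalkStructureMap π y ≫ X.presheaf.stalkSpecializes h = stalkStructureMap π x := by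
  apply Spec.map_injective
  rw [Spec.map_comp, SpecMap_stalkStructureMap, SpecMap_stalkStructureMap,
    SpecMap_stalkSpecializes_fromSpecStalk_assoc]

/-- Uniqueness in the valuative criterion. -/
theorem eq_of_specMap_comp_eq {Y : Scheme.{0}} (π : X ⟶ Y) [IsSeparated π] {R K : Type}
    [CommRing R] [IsDomain R]
    [ValuationRing R] [Field K] [Algebra R K] [IsFractionRing R K] {l₁ l₂ : Spec (.of R) ⟶ X}
    (h : Spec.map (CommRingCat.ofHom (algebraMap R K)) ≫ l₁ =
      Spec.map (CommRingCat.ofHom (algebraMap R K)) ≫ l₂)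
    (h' : l₁ ≫ π = l₂ ≫ π) : l₁ = l₂ := by
  let S : ValuativeCommSq π :=
    { R := R
      K := K
      i₁ := Spec.map (CommRingCat.ofHom (algebraMap R K)) ≫ l₁
      i₂ := l₁ ≫ π
      commSq := ⟨Category.assoc _ _ _⟩ }
  exact congrArg CommSq.LiftStruct.l ((IsSeparated.valuativeCriterion π S).elim
    ⟨l₁, rfl, rfl⟩ ⟨l₂, h.symm, h'.symm⟩)

theorem exists_isClosed_specializes [CompactSpace X] (y : X) :
    ∃ x : X, IsClosed ({x} : Set X) ∧ y ⤳ x := by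
  obtain ⟨x, hx, hx'⟩ := IsClosed.exists_closed_singleton (isClosed_closure (s := {y}))
    ⟨y, subset_closure rfl⟩
  exact ⟨x, hx', specializes_iff_mem_closure.2 hx⟩

variable [IsIntegral X]

/-- The function field of a `k`-scheme as a `k`-algebra. -/
noncomputable abbrev functionFieldAlgebra : Algebra k X.functionField :=
  (stalkStructureMap π (genericPoint X)).hom.toAlgebra

theorem algebraMap_stalkStructureMap (x : X) (c : k) :
    letI := functionFieldAlgebra π
    algebraMap (X.presheaf.stalk x) X.functionField ((stalkStructureMap π x).hom c) =
      algebraMap k X.functionField c := by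
  have := stalkStructureMap_comp_stalkSpecializes π (genericPoint_specializes x)
  exact congrArg (fun f ↦ f.hom c) this

/-- Points of a separated integral scheme are separated by their local rings. -/
theorem eq_of_range_stalk_eq [IsSeparated π] {x y : X} [ValuationRing (X.presheaf.stalk x)]
    (h : (algebraMap (X.presheaf.stalk x) X.functionField).range =
      (algebraMap (X.presheaf.stalk y) X.functionField).range) : x = y := by
  have hx := IsFractionRing.injective (X.presheaf.stalk x) X.functionField
  have hy := IsFractionRing.injective (X.presheaf.stalk y) X.functionField
  obtain ⟨θ, hθ⟩ := RingHom.exists_factor_of_injective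
    (algebraMap (X.presheaf.stalk y) X.functionField) _ hx (fun a ↦ h.ge ⟨a, rfl⟩)
  obtain ⟨ψ, hψ⟩ := RingHom.exists_factor_of_injective
    (algebraMap (X.presheaf.stalk x) X.functionField) _ hy (fun a ↦ h.le ⟨a, rfl⟩)
  have hloc : IsLocalHom θ := ⟨fun a ha ↦ by
    have : ψ (θ a) = a := hy (by rw [hψ, hθ])
    exact this ▸ ha.map ψ⟩
  obtain ⟨Θ, rfl⟩ : ∃ Θ : X.presheaf.stalk y ⟶ X.presheaf.stalk x, Θ.hom = θ :=
    ⟨CommRingCat.ofHom θ, rfl⟩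
  have hθ' : Θ ≫ X.presheaf.stalkSpecializes (genericPoint_specializes x) =
      X.presheaf.stalkSpecializes (genericPoint_specializes y) := by
    ext a
    exact hθ a
  have hθk : stalkStructureMap π y ≫ Θ = stalkStructureMap π x := by
    ext c
    apply hx
    exact (hθ _).trans ((algebraMap_stalkStructureMap π y c).trans
      (algebraMap_stalkStructureMap π x c).symm)
  have hl' : X.fromSpecStalk x = Spec.map Θ ≫ X.fromSpecStalk y := by
    refine eq_of_specMap_comp_eq (R := X.presheaf.stalk x) (K := X.functionField) π ?_ ?_
    · change Spec.map (X.presheaf.stalkSpecializes (genericPoint_specializes x)) ≫ _ =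
        Spec.map (X.presheaf.stalkSpecializes (genericPoint_specializes x)) ≫ _
      rw [← Spec.map_comp_assoc, hθ', SpecMap_stalkSpecializes_fromSpecStalk,
        SpecMap_stalkSpecializes_fromSpecStalk]
    · rw [Category.assoc, ← SpecMap_stalkStructureMap, ← SpecMap_stalkStructureMap,
        ← Spec.map_comp, hθk]
  have h1 : X.fromSpecStalk x (IsLocalRing.closedPoint (X.presheaf.stalk x)) =
      X.fromSpecStalk y (Spec.map Θ (IsLocalRing.closedPoint (X.presheaf.stalk x))) := by
    rw [hl']
    rfl
  have h2 : Spec.map Θ (IsLocalRing.closedPoint (X.presheaf.stalk x)) =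
      IsLocalRing.closedPoint (X.presheaf.stalk y) := IsLocalRing.comap_closedPoint Θ.hom
  rwa [h2, fromSpecStalk_closedPoint, fromSpecStalk_closedPoint] at h1

/-- Every valuation ring of the function field of a complete variety has a centre. -/
theorem exists_range_stalk_le [UniversallyClosed π] [CompactSpace X]
    (V : ValuationSubring X.functionField)
    (hV : letI := functionFieldAlgebra π; ∀ c : k, algebraMap k X.functionField c ∈ V) :
    ∃ x : X, IsClosed ({x} : Set X) ∧
      ∀ a, algebraMap (X.presheaf.stalk x) X.functionField a ∈ V := by
  let := functionFieldAlgebra π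
  let g : CommRingCat.of k ⟶ CommRingCat.of V :=
    CommRingCat.ofHom ((algebraMap k X.functionField).codRestrict V.toSubring hV)
  have hg : g ≫ CommRingCat.ofHom (algebraMap V X.functionField) =
      stalkStructureMap π (genericPoint X) := rfl
  let S : ValuativeCommSq π :=
    { R := V
      K := X.functionField
      i₁ := X.fromSpecStalk (genericPoint X)
      i₂ := Spec.map g
      commSq := ⟨by
        change X.fromSpecStalk (genericPoint X) ≫ π =
          Spec.map (CommRingCat.ofHom (algebraMap V X.functionField)) ≫ Spec.map g
        rw [← Spec.map_comp, hg, SpecMap_stalkStructureMap]⟩ }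
  have hex : ValuativeCriterion.Existence π := by
    have : UniversallyClosed π := inferInstance
    rw [UniversallyClosed.eq_valuativeCriterion] at this
    exact this.1
  obtain ⟨⟨l⟩⟩ := hex S
  let f : Spec (CommRingCat.of V) ⟶ X := l.l
  have hf : Spec.map (CommRingCat.ofHom (algebraMap V X.functionField)) ≫ f =
      X.fromSpecStalk (genericPoint X) := l.fac_left
  let y := f (IsLocalRing.closedPoint V)
  let t : X.presheaf.stalk y ⟶ CommRingCat.of V := stalkClosedPointTo f
  have ht : Spec.map t ≫ X.fromSpecStalk y = f := Spec_stalkClosedPointTo_fromSpecStalk f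
  have ht' : t ≫ CommRingCat.ofHom (algebraMap V X.functionField) =
      X.presheaf.stalkSpecializes (genericPoint_specializes y) := by
    apply Spec.map_injective
    rw [← cancel_mono (X.fromSpecStalk y), SpecMap_stalkSpecializes_fromSpecStalk,
      Spec.map_comp, Category.assoc, ht, hf]
  obtain ⟨x, hx, hyx⟩ := exists_isClosed_specializes y
  refine ⟨x, hx, fun a ↦ ?_⟩
  have h1 : algebraMap (X.presheaf.stalk x) X.functionField a =
      (t (X.presheaf.stalkSpecializes hyx a) : V).1 := by
    have h2 : X.presheaf.stalkSpecializes hyx ≫ t ≫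
        CommRingCat.ofHom (algebraMap V X.functionField) =
        X.presheaf.stalkSpecializes (genericPoint_specializes x) := by
      rw [ht', TopCat.Presheaf.stalkSpecializes_comp]
    exact (congrArg (fun f ↦ f.hom a) h2).symm
  rw [h1]
  exact (t (X.presheaf.stalkSpecializes hyx a) : V).2

/-- The local rings at the closed points of a complete nonsingular curve. -/
theorem isCompleteFamily_stalk [IsProper π]
    (hX : ∀ x : X, IsClosed ({x} : Set X) → IsDiscreteValuationRing (X.presheaf.stalk x)) :
    letI := functionFieldAlgebra π
    IsCompleteFamily k X.functionField
      (fun x : {x : X // IsClosed ({x} : Set X)} ↦ X.presheaf.stalk x.1) := by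
  let := functionFieldAlgebra π
  have : CompactSpace X := by
    have : QuasiCompact π := inferInstance
    exact (quasiCompact_iff_compactSpace (f := π)).1 this
  refine ⟨fun x c ↦ ⟨_, algebraMap_stalkStructureMap π x.1 c⟩, fun x y h ↦ ?_, fun V hV ↦ ?_⟩
  · have := hX x.1 x.2
    exact Subtype.ext (eq_of_range_stalk_eq π h)
  · obtain ⟨x, hx, h⟩ := exists_range_stalk_le π V hV
    exact ⟨⟨x, hx⟩, h⟩

end AlgebraicGeometry.Scheme

/-! ### Principal divisors on a complete curve -/

namespace AlgebraicGeometry.Scheme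

variable {X : Scheme.{0}} {k : Type} [Field k] (π : X ⟶ Spec (.of k)) [IsIntegral X]

/-- The homomorphism from the base field to the coordinate ring of an affine open subset. -/
noncomputable def affineStructureMap {U : X.Opens} (hU : IsAffineOpen U) :
    CommRingCat.of k ⟶ Γ(X, U) :=
  Spec.preimage (hU.fromSpec ≫ π)

omit [IsIntegral X] in
theorem affineStructureMap_germ {U : X.Opens} (hU : IsAffineOpen U) {x : X} (hx : x ∈ U) :
    affineStructureMap π hU ≫ X.presheaf.germ U x hx = stalkStructureMap π x := by
  apply Spec.map_injective
  rw [SpecMap_stalkStructureMap, Spec.map_comp, affineStructureMap, Spec.map_preimage,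
    ← hU.fromSpecStalk_eq_fromSpecStalk hx, IsAffineOpen.fromSpecStalk, Category.assoc]

/-- Affine open subsets of a nonsingular curve have dimension at most one: by the Nullstellensatz,
their closed points are closed in the whole curve. -/
theorem dimensionLEOne_of_isAffineOpen [LocallyOfFiniteType π]
    (hX : ∀ x : X, IsClosed ({x} : Set X) → IsDiscreteValuationRing (X.presheaf.stalk x))
    {U : X.Opens} [Nonempty U] (hU : IsAffineOpen U) : Ring.DimensionLEOne Γ(X, U) := by
  have : JacobsonSpace X := LocallyOfFiniteType.jacobsonSpace π
  refine Ring.DimensionLEOne.of_isDiscreteValuationRing fun m hm ↦ ?_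
  let z : PrimeSpectrum Γ(X, U) := ⟨m, hm.isPrime⟩
  have hz : hU.fromSpec z ∈ U := by
    rw [← SetLike.mem_coe, ← hU.range_fromSpec]
    exact ⟨z, rfl⟩
  have hcl : IsClosed ({hU.fromSpec z} : Set X) := by
    apply isClosed_singleton_of_isLocallyClosed_singleton
    have h1 : IsLocallyClosed ({z} : Set (Spec Γ(X, U))) :=
      (PrimeSpectrum.isClosed_singleton_iff_isMaximal z |>.2 hm).isLocallyClosed
    have h2 := h1.image (f := hU.fromSpec) hU.fromSpec.isOpenEmbedding.isInducing
      hU.fromSpec.isOpenEmbedding.isOpen_range.isLocallyClosed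
    have h3 : hU.fromSpec '' ({z} : Set (Spec Γ(X, U))) = {hU.fromSpec z} :=
      Set.image_singleton (f := hU.fromSpec) (a := (z : Spec Γ(X, U)))
    exact h3 ▸ h2
  let := (X.presheaf.germ U (hU.fromSpec z) hz).hom.toAlgebra
  exact ⟨X.presheaf.stalk (hU.fromSpec z), inferInstance, inferInstance, this,
    hU.isLocalization_stalk' z hz, hX _ hcl⟩

open IntermediateField in
/-- The function field of a curve is finite over the subfield generated by any nonconstant
function. -/
theorem finiteDimensional_functionField [LocallyOfFiniteType π]
    (hX : ∀ x : X, IsClosed ({x} : Set X) → IsDiscreteValuationRing (X.presheaf.stalk x))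
    (f : X.functionField) :
    letI := functionFieldAlgebra π
    Transcendental k f → FiniteDimensional k⟮f⟯ X.functionField := by
  intro hf
  let := functionFieldAlgebra π
  obtain ⟨U, hU, -, hne, -⟩ := exists_isUnit_germ_eq X (1 : X.functionField) one_ne_zero
  replace hU : IsAffineOpen U := hU
  have := dimensionLEOne_of_isAffineOpen π hX hU
  have := functionField_isFractionRing_of_isAffineOpen X U hU
  let := (affineStructureMap π hU).hom.toAlgebra
  have hη : genericPoint X ∈ U :=
    ((genericPoint_spec X).mem_open_set_iff U.isOpen).mpr (by simpa using hne)
  have htow : IsScalarTower k Γ(X, U) X.functionField :=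
    IsScalarTower.of_algebraMap_eq fun c ↦
      (congrArg (fun f ↦ f.hom c) (affineStructureMap_germ π hU hη)).symm
  have hft : Algebra.FiniteType k Γ(X, U) := by
    have h : LocallyOfFiniteType (Spec.map (affineStructureMap π hU)) := by
      rw [show Spec.map (affineStructureMap π hU) = hU.fromSpec ≫ π from Spec.map_preimage _]
      infer_instance
    exact (HasRingHomProperty.Spec_iff (P := @LocallyOfFiniteType)).1 h
  exact hf.finiteDimensional_adjoin (B := Γ(X, U))

section Ord

variable [IsLocallyNoetherian X]
  (hX : ∀ x : X, IsClosed ({x} : Set X) → IsDiscreteValuationRing (X.presheaf.stalk x))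

omit [IsIntegral X] [IsLocallyNoetherian X] in
theorem coheight_eq_one_of_isDiscreteValuationRing {x : X} [IsDomain (X.presheaf.stalk x)]
    [IsDiscreteValuationRing (X.presheaf.stalk x)] : Order.coheight x = 1 := by
  have h := ringKrullDim_stalk_eq_coheight x
  rw [IsDiscreteValuationRing.ringKrullDim_eq_one] at h
  exact_mod_cast h.symm

/-- The order at a point with a discrete valuation ring as local ring is the normalized
valuation. For `f = 0`, both sides have the default value zero. -/
theorem ord_eq_dvrOrd (f : X.functionField) (x : X)
    [IsDiscreteValuationRing (X.presheaf.stalk x)] :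
    ord f x = dvrOrd (X.presheaf.stalk x) f := by
  have hx : Order.coheight x = 1 := coheight_eq_one_of_isDiscreteValuationRing
  by_cases hf : f = 0
  · simp [hf, dvrOrd]
  rw [ord_eq_iff hx hf]
  exact (WithZero.exp_log (show Ring.ordFrac (X.presheaf.stalk x) f ≠ 0 from
    (map_ne_zero _).2 hf)).symm

include hX in
theorem ord_eq_zero_of_not_isClosed [CompactSpace X] (f : X.functionField) {x : X}
    (hx : ¬ IsClosed ({x} : Set X)) : ord f x = 0 := by
  apply ord_eq_zero_of_coheight_neq_one
  intro h
  -- a non-closed point of codimension one would specialize to a closed one of larger codimension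
  obtain ⟨y, hy, hxy⟩ := exists_isClosed_specializes x
  have := hX y hy
  have h1 : Order.coheight y = 1 := coheight_eq_one_of_isDiscreteValuationRing
  have hle : y ≤ x := hxy
  have hlt : y < x := lt_of_le_not_ge hle fun h' ↦ hx ((Specializes.antisymm hxy h').eq ▸ hy)
  have := Order.coheight_strictAnti hlt (by rw [h]; exact ENat.one_lt_top)
  rw [h, h1] at this
  exact lt_irrefl _ this

include hX in
/-- Principal divisors on a complete nonsingular curve have degree zero. -/
theorem finsum_ord [IsAlgClosed k] [CharZero k] [IsProper π] (f : X.functionField) :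
    {x | ord f x ≠ 0}.Finite ∧ ∑ᶠ x, ord f x = 0 := by
  let := functionFieldAlgebra π
  have : CompactSpace X := by
    have : QuasiCompact π := inferInstance
    exact (quasiCompact_iff_compactSpace (f := π)).1 this
  let S : Set X := {x | IsClosed ({x} : Set X)}
  have hdvr : ∀ x : S, IsDiscreteValuationRing (X.presheaf.stalk x.1) := fun x ↦ hX x.1 x.2
  obtain ⟨h1, h2⟩ := (isCompleteFamily_stalk π hX).finsum_dvrOrd
    (finiteDimensional_functionField π hX) f
  have hsupp : {x | ord f x ≠ 0} ⊆ S := fun x hx ↦ by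
    by_contra h
    exact hx (ord_eq_zero_of_not_isClosed hX f h)
  have heq : ∀ x : S, dvrOrd (X.presheaf.stalk x.1) f = ord f x.1 := fun x ↦
    (ord_eq_dvrOrd f x.1).symm
  constructor
  · refine (h1.image Subtype.val).subset fun x hx ↦ ⟨⟨x, hsupp hx⟩, ?_, rfl⟩
    exact (heq ⟨x, hsupp hx⟩).trans_ne hx
  · replace h2 := (finsum_congr heq).symm.trans h2
    rw [← h2]
    refine Eq.trans ?_ (finsum_set_coe_eq_finsum_mem (f := ord f) S).symm
    rw [← finsum_mem_univ]
    exact finsum_mem_inter_support_eq _ _ _ (by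
      rw [Set.univ_inter, eq_comm]; exact Set.inter_eq_right.2 hsupp)

end Ord

end AlgebraicGeometry.Scheme

/-! ### Sections, frames and orders of vanishing -/

namespace LineBundle

section Restriction

variable {X : Scheme.{0}} {M N : X.Modules} {U V W : X.Opens}

/-- The restriction of a function to a smaller open set. -/
noncomputable abbrev resFun (h : V ≤ U) (a : Γ(X, U)) : Γ(X, V) :=
  X.presheaf.map (homOfLE h).op a

theorem resFun_mul (h : V ≤ U) (a b : Γ(X, U)) : resFun h (a * b) = resFun h a * resFun h b :=
  map_mul _ _ _

theorem resFun_resFun (h : V ≤ U) (h' : W ≤ V) (a : Γ(X, U)) :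
    resFun h' (resFun h a) = resFun (h'.trans h) a := by
  simp only [resFun, ← ConcreteCategory.comp_apply, ← Functor.map_comp, ← op_comp, homOfLE_comp]

@[simp]
theorem res_res (h : V ≤ U) (h' : W ≤ V) (s : Γ(M, U)) :
    res h' (res h s) = res (h'.trans h) s := by
  simp only [res, ← ConcreteCategory.comp_apply, ← Functor.map_comp, ← op_comp, homOfLE_comp]

@[simp]
theorem res_self (h : U ≤ U) (s : Γ(M, U)) : res h s = s := by
  simp [res]

@[simp]
theorem res_smul (h : V ≤ U) (a : Γ(X, U)) (s : Γ(M, U)) :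
    res h (a • s) = resFun h a • res h s :=
  Scheme.Modules.map_smul M (homOfLE h) a s

@[simp]
theorem res_add (h : V ≤ U) (s t : Γ(M, U)) : res h (s + t) = res h s + res h t :=
  map_add _ _ _

@[simp]
theorem res_zero (h : V ≤ U) : res h (0 : Γ(M, U)) = 0 := map_zero _

theorem app_res (φ : M ⟶ N) (h : V ≤ U) (s : Γ(M, U)) :
    Scheme.Modules.Hom.app φ V (res h s) = res h (Scheme.Modules.Hom.app φ U s) :=
  ConcreteCategory.congr_hom (φ.mapPresheaf.naturality (homOfLE h).op) s

theorem eq_of_locally_eq (s t : Γ(M, U))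
    (h : ∀ x ∈ U, ∃ (V : X.Opens) (hV : V ≤ U), x ∈ V ∧ res hV s = res hV t) : s = t := by
  choose V hV hx heq using fun x : U ↦ h x.1 x.2
  refine TopCat.Sheaf.eq_of_locally_eq' ⟨M.presheaf, M.isSheaf⟩ V U (fun x ↦ homOfLE (hV x))
    (fun x hxU ↦ ?_) s t fun x ↦ heq x
  exact TopologicalSpace.Opens.mem_iSup.2 ⟨⟨x, hxU⟩, hx _⟩

theorem exists_gluing {ι : Type} (V : ι → X.Opens) (hV : ∀ i, V i ≤ U)
    (hcov : ∀ x ∈ U, ∃ i, x ∈ V i) (s : ∀ i, Γ(M, V i))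
    (hs : ∀ i j, res (inf_le_left : V i ⊓ V j ≤ V i) (s i) = res inf_le_right (s j)) :
    ∃ t : Γ(M, U), ∀ i, res (hV i) t = s i := by
  obtain ⟨t, ht, -⟩ := TopCat.Sheaf.existsUnique_gluing' ⟨M.presheaf, M.isSheaf⟩ V U
    (fun i ↦ homOfLE (hV i)) (fun x hxU ↦ TopologicalSpace.Opens.mem_iSup.2 (hcov x hxU)) s
    fun i j ↦ hs i j
  exact ⟨t, ht⟩

theorem eq_of_not_nonempty (hU : ¬ Nonempty U) (s t : Γ(M, U)) : s = t :=
  eq_of_locally_eq s t fun x hx ↦ (hU ⟨⟨x, hx⟩⟩).elim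

theorem IsFrame.res {e : Γ(M, U)} (he : IsFrame e) (h : V ≤ U) : IsFrame (res h e) :=
  fun W hW ↦ by simpa using he W (hW.trans h)

theorem IsFrame.exists_smul {e : Γ(M, U)} (he : IsFrame e) (t : Γ(M, U)) :
    ∃ a : Γ(X, U), t = a • e := by
  obtain ⟨a, ha⟩ := (he U le_rfl).2 t
  exact ⟨a, by simpa using ha.symm⟩

theorem IsFrame.smul_left_injective {e : Γ(M, U)} (he : IsFrame e) {a b : Γ(X, U)}
    (h : a • e = b • e) : a = b :=
  (he U le_rfl).1 (by simpa using h)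

theorem IsFrame.exists_isUnit {e e' : Γ(M, U)} (he : IsFrame e) (he' : IsFrame e') :
    ∃ u : Γ(X, U), IsUnit u ∧ e' = u • e := by
  obtain ⟨u, hu⟩ := he.exists_smul e'
  obtain ⟨v, hv⟩ := he'.exists_smul e
  refine ⟨u, IsUnit.of_mul_eq_one v ?_, hu⟩
  apply he'.smul_left_injective
  rw [mul_smul, ← hv, ← hu, one_smul]

theorem IsFrame.smul {e : Γ(M, U)} (he : IsFrame e) {u : Γ(X, U)} (hu : IsUnit u) :
    IsFrame (u • e) := by
  intro V h
  have hu' : IsUnit (resFun h u) := hu.map (X.presheaf.map (homOfLE h).op).hom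
  have : (fun a : Γ(X, V) ↦ a • LineBundle.res h (u • e)) =
      (fun a ↦ a • LineBundle.res h e) ∘ fun a ↦ a * resFun h u := by
    ext a
    simp [mul_smul]
  rw [this]
  exact (he V h).comp (IsUnit.isUnit_iff_mulRight_bijective.1 hu')

end Restriction

section Integral

variable {X : Scheme.{0}} [IsIntegral X] {M N : X.Modules} {U V W : X.Opens}

theorem nonempty_inf (U V : X.Opens) [hU : Nonempty U] [hV : Nonempty V] :
    Nonempty (U ⊓ V).toScheme := by
  obtain ⟨x, hx⟩ := nonempty_preirreducible_inter U.isOpen V.isOpen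
    ⟨_, hU.some.2⟩ ⟨_, hV.some.2⟩
  exact ⟨⟨x, hx⟩⟩

theorem resFun_injective [Nonempty V] (h : V ≤ U) : Function.Injective (resFun (X := X) h) :=
  map_injective_of_isIntegral X (homOfLE h)

@[simp]
theorem germ_resFun [Nonempty U] [Nonempty V] (h : V ≤ U) (a : Γ(X, U)) :
    X.germToFunctionField V (resFun h a) = X.germToFunctionField U a :=
  X.presheaf.germ_res_apply _ _ _ _

/-- A section of a line bundle on an integral scheme which vanishes on a nonempty open subset is
zero. -/
theorem IsLineBundle.eq_zero_of_res_eq_zero (hM : IsLineBundle M) [Nonempty V] (h : V ≤ U)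
    {s : Γ(M, U)} (hs : res h s = 0) : s = 0 := by
  refine eq_of_locally_eq s 0 fun x hx ↦ ?_
  obtain ⟨W, e, hxW, he⟩ := hM x
  refine ⟨U ⊓ W, inf_le_left, ⟨hx, hxW⟩, ?_⟩
  have he' := he.res (inf_le_right : U ⊓ W ≤ W)
  obtain ⟨a, ha⟩ := he'.exists_smul (res inf_le_left s)
  have : Nonempty (U ⊓ W).toScheme := ⟨⟨x, hx, hxW⟩⟩
  have := nonempty_inf (U ⊓ W) V
  have h1 : resFun (inf_le_left : (U ⊓ W) ⊓ V ≤ U ⊓ W) a = 0 := by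
    apply (he'.res inf_le_left).smul_left_injective
    rw [zero_smul, ← res_smul, ← ha, res_res]
    have := congrArg (res (inf_le_right : (U ⊓ W) ⊓ V ≤ V)) hs
    simpa using this
  have h2 : a = 0 := resFun_injective inf_le_left (h1.trans (map_zero _).symm)
  rw [ha, h2, zero_smul, res_zero]

theorem IsLineBundle.res_injective (hM : IsLineBundle M) [Nonempty V] (h : V ≤ U) :
    Function.Injective (LineBundle.res h : Γ(M, U) → Γ(M, V)) := fun s t hst ↦ by
  rw [← sub_eq_zero]
  refine hM.eq_zero_of_res_eq_zero h ?_
  have : LineBundle.res h (s - t) = LineBundle.res h s - LineBundle.res h t := map_sub _ _ _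
  rw [this, hst, sub_self]

variable [IsLocallyNoetherian X]

/-- The order of a section does not depend on the frame: two frames differ by a unit. -/
theorem HasOrder.unique {t : Γ(M, U)} {x : X} {m n : ℤ} (hm : HasOrder t x m)
    (hn : HasOrder t x n) : m = n := by
  obtain ⟨V, e, W, hU, hV, hW, a, hx, he, ha, rfl⟩ := hm
  obtain ⟨V', e', W', hU', hV', hW', a', hx', he', ha', rfl⟩ := hn
  have hVV : Nonempty (V ⊓ V').toScheme := ⟨⟨x, hx, hx'⟩⟩
  have hWW := nonempty_inf W W'
  obtain ⟨u, hu, hue⟩ := (he.res (inf_le_left : V ⊓ V' ≤ V)).exists_isUnit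
    (he'.res (inf_le_right : V ⊓ V' ≤ V'))
  have hle : W ⊓ W' ≤ V ⊓ V' := inf_le_inf hV hV'
  have h1 : resFun inf_le_left a = resFun inf_le_right a' * resFun hle u := by
    apply (he.res (inf_le_left.trans hV : W ⊓ W' ≤ V)).smul_left_injective
    have h2 := congrArg (res (inf_le_left : W ⊓ W' ≤ W)) ha
    have h3 := congrArg (res (inf_le_right : W ⊓ W' ≤ W')) ha'
    have h4 := congrArg (res hle) hue
    simp only [res_res, res_smul] at h2 h3 h4
    rw [← h2, mul_smul, h3, h4]
  have h2 := congrArg (X.germToFunctionField (W ⊓ W')) h1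
  rw [map_mul, germ_resFun, germ_resFun, germ_resFun] at h2
  rw [h2]
  by_cases h0 : X.germToFunctionField W' a' = 0
  · rw [h0, zero_mul]
  have hu0 : X.germToFunctionField (V ⊓ V') u ≠ 0 := (hu.map _).ne_zero
  rw [Scheme.ord_mul h0 hu0, Scheme.ord_of_isUnit hu ⟨hx, hx'⟩, add_zero]

theorem HasOrder.order_eq {t : Γ(M, U)} {x : X} {n : ℤ} (h : HasOrder t x n) : order t x = n := by
  have hex : ∃ n, HasOrder t x n := ⟨n, h⟩
  rw [order, dif_pos hex]
  exact hex.choose_spec.unique h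

theorem order_eq_ord {t : Γ(M, U)} {x : X} {e : Γ(M, V)} (he : IsFrame e) (hx : x ∈ V)
    [Nonempty W] (hU : W ≤ U) (hV : W ≤ V) {a : Γ(X, W)} (ha : res hU t = a • res hV e) :
    order t x = Scheme.ord (X.germToFunctionField W a) x :=
  HasOrder.order_eq ⟨V, e, W, hU, hV, ‹_›, a, hx, he, ha, rfl⟩

/-- The quotient of two nonzero sections of a line bundle is a rational function, whose divisor is
the difference of theirs. -/
theorem IsLineBundle.exists_order_eq_add (hM : IsLineBundle M) [Nonempty U] [Nonempty V]
    {s : Γ(M, U)} {t : Γ(M, V)} (hs : s ≠ 0) (ht : t ≠ 0) :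
    ∃ f : X.functionField, ∀ x, order s x = order t x + Scheme.ord f x := by
  obtain ⟨V₀, e, hV₀, he⟩ := hM (genericPoint X)
  have : Nonempty V₀ := ⟨⟨_, hV₀⟩⟩
  have := nonempty_inf U V
  have := nonempty_inf (U ⊓ V) V₀
  have hfun : ∀ {V' : X.Opens} (e' : Γ(M, V')) (he' : IsFrame e') (W : X.Opens) [Nonempty W]
    (hWU : W ≤ U) (hWV : W ≤ V) (hW : W ≤ V'), ∃ a b : Γ(X, W), a ≠ 0 ∧ b ≠ 0 ∧
      res hWU s = a • res hW e' ∧ res hWV t = b • res hW e' := by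
    intro V' e' he' W _ hWU hWV hW
    obtain ⟨a, ha⟩ := (he'.res hW).exists_smul (res hWU s)
    obtain ⟨b, hb⟩ := (he'.res hW).exists_smul (res hWV t)
    refine ⟨a, b, ?_, ?_, ha, hb⟩
    · rintro rfl
      rw [zero_smul] at ha
      exact hs (hM.eq_zero_of_res_eq_zero hWU ha)
    · rintro rfl
      rw [zero_smul] at hb
      exact ht (hM.eq_zero_of_res_eq_zero hWV hb)
  obtain ⟨a, b, ha0, hb0, ha, hb⟩ := hfun e he (U ⊓ V ⊓ V₀) (inf_le_left.trans inf_le_left)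
    (inf_le_left.trans inf_le_right) inf_le_right
  have hne : ∀ {W : X.Opens} [Nonempty W] {a : Γ(X, W)}, a ≠ 0 → X.germToFunctionField W a ≠ 0 :=
    fun h ↦ (map_ne_zero_iff _ (Scheme.germToFunctionField_injective X _)).2 h
  refine ⟨X.germToFunctionField _ a / X.germToFunctionField _ b, fun x ↦ ?_⟩
  obtain ⟨V', e', hx, he'⟩ := hM x
  have : Nonempty V' := ⟨⟨_, hx⟩⟩
  have := nonempty_inf (U ⊓ V ⊓ V₀) V'
  obtain ⟨a', b', ha0', hb0', ha', hb'⟩ := hfun e' he' (U ⊓ V ⊓ V₀ ⊓ V')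
    (inf_le_left.trans (inf_le_left.trans inf_le_left))
    (inf_le_left.trans (inf_le_left.trans inf_le_right)) inf_le_right
  rw [order_eq_ord he' hx _ _ ha', order_eq_ord he' hx _ _ hb', ← Scheme.ord_mul (hne hb0')
    (div_ne_zero (hne ha0) (hne hb0))]
  congr 1
  have h1 : a' * resFun inf_le_left b = b' * resFun inf_le_left a := by
    obtain ⟨u, -, hue⟩ := (he'.res (inf_le_right : U ⊓ V ⊓ V₀ ⊓ V' ≤ V')).exists_isUnit
      (he.res (inf_le_left.trans inf_le_right))
    have h2 := congrArg (res (inf_le_left : U ⊓ V ⊓ V₀ ⊓ V' ≤ _)) ha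
    have h3 := congrArg (res (inf_le_left : U ⊓ V ⊓ V₀ ⊓ V' ≤ _)) hb
    simp only [res_res, res_smul] at h2 h3
    rw [ha', hue, ← mul_smul] at h2
    rw [hb', hue, ← mul_smul] at h3
    have h4 := (he'.res _).smul_left_injective h2
    have h5 := (he'.res _).smul_left_injective h3
    rw [h4, h5]
    ring
  have h2 := congrArg (X.germToFunctionField (U ⊓ V ⊓ V₀ ⊓ V')) h1
  rw [map_mul, map_mul, germ_resFun, germ_resFun] at h2
  rw [mul_div_assoc', eq_div_iff (hne hb0), h2]

end Integral

/-! ### The degree of a line bundle -/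

section Degree

variable {X : Scheme.{0}} [IsIntegral X] [IsLocallyNoetherian X] {M N : X.Modules}
  {U V : X.Opens} {k : Type} [Field k] [IsAlgClosed k] [CharZero k] (π : X ⟶ Spec (.of k))
  [IsProper π]
  (hX : ∀ x : X, IsClosed ({x} : Set X) → IsDiscreteValuationRing (X.presheaf.stalk x))

include π hX in
/-- The divisor of a rational section is finite: the curve is covered by finitely many open sets on
each of which it is a principal divisor. -/
theorem IsLineBundle.finite_order_ne_zero (hM : IsLineBundle M) [Nonempty U] (t : Γ(M, U)) :
    {x | order t x ≠ 0}.Finite := by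
  have : CompactSpace X := by
    have : QuasiCompact π := inferInstance
    exact (quasiCompact_iff_compactSpace (f := π)).1 this
  choose V e hx he using hM
  obtain ⟨T, hT⟩ := CompactSpace.elim_nhds_subcover (fun x ↦ (V x : Set X))
    fun x ↦ (V x).isOpen.mem_nhds (hx x)
  have hfin : ∀ x : X, ∃ f : X.functionField, ∀ y ∈ V x, order t y = Scheme.ord f y := fun x ↦ by
    have : Nonempty (V x) := ⟨⟨x, hx x⟩⟩
    have := nonempty_inf U (V x)
    obtain ⟨a, ha⟩ := ((he x).res (inf_le_right : U ⊓ V x ≤ V x)).exists_smul (res inf_le_left t)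
    exact ⟨_, fun y hy ↦ order_eq_ord (he x) hy _ _ ha⟩
  choose f hf using hfin
  refine (T.finite_toSet.biUnion fun x _ ↦ (Scheme.finsum_ord π hX (f x)).1).subset fun y hy ↦ ?_
  have hyT : y ∈ ⋃ x ∈ T, (V x : Set X) := hT ▸ Set.mem_univ y
  simp only [Set.mem_iUnion] at hyT ⊢
  obtain ⟨x, hxT, hyx⟩ := hyT
  exact ⟨x, hxT, by rw [Set.mem_ofPred_eq, ← hf x y hyx]; exact hy⟩

include π hX in
/-- The degree of a line bundle can be computed with any nonzero rational section. -/
theorem IsLineBundle.degree_eq (hM : IsLineBundle M) [Nonempty U] {s : Γ(M, U)} (hs : s ≠ 0) :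
    degree M = ∑ᶠ x, order s x := by
  have hex : ∃ p : (Σ U : X.Opens, Γ(M, U)), p.2 ≠ 0 := ⟨⟨U, s⟩, hs⟩
  rw [degree, dif_pos hex]
  have : Nonempty hex.choose.1 := by
    by_contra h
    exact hex.choose_spec (eq_of_not_nonempty h _ _)
  obtain ⟨f, hf⟩ := hM.exists_order_eq_add hs hex.choose_spec
  obtain ⟨h1, h2⟩ := Scheme.finsum_ord π hX f
  rw [finsum_congr hf, finsum_add_distrib (hM.finite_order_ne_zero π hX _) h1, h2, add_zero]

include π hX in
/-- A section of a line bundle whose divisor is at most that of a section of a line bundle of at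
most the same degree has the same divisor. -/
theorem IsLineBundle.order_eq_of_le (hM : IsLineBundle M) (hN : IsLineBundle N)
    (hd : degree N ≤ degree M) {s : Γ(M, ⊤)} {t : Γ(N, ⊤)} (hs : s ≠ 0) (ht : t ≠ 0)
    (h : ∀ x, order s x ≤ order t x) (x : X) : order s x = order t x := by
  have : Nonempty (⊤ : X.Opens).toScheme := ⟨⟨x, trivial⟩⟩
  have h1 := hM.finite_order_ne_zero π hX s
  have h2 := hN.finite_order_ne_zero π hX t
  rw [hM.degree_eq π hX hs, hN.degree_eq π hX ht] at hd
  by_contra hne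
  have hsum : ∑ᶠ x, (order t x - order s x) ≤ 0 := by
    rw [finsum_sub_distrib h2 h1]
    omega
  have hpos : 0 < ∑ᶠ x, (order t x - order s x) := by
    refine finsum_pos (fun x ↦ sub_nonneg.2 (h x)) ⟨x, ?_⟩ ((h1.union h2).subset fun y hy ↦ ?_)
    · have := h x
      omega
    · simp only [Function.mem_support, Set.mem_union, Set.mem_ofPred_eq] at hy ⊢
      omega
  omega

end Degree

/-! ### Homomorphisms of line bundles -/

section Hom

variable {X : Scheme.{0}} [IsIntegral X] {M N : X.Modules}
  {U V : X.Opens}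

/-- A nonzero homomorphism of line bundles is injective on sections. -/
theorem IsLineBundle.hom_eq_zero (hM : IsLineBundle M) (hN : IsLineBundle N) (φ : M ⟶ N)
    {s : Γ(M, ⊤)} (hs : s ≠ 0) (h : Scheme.Modules.Hom.app φ ⊤ s = 0) : φ = 0 := by
  apply Scheme.Modules.hom_ext
  intro U
  ext t
  change Scheme.Modules.Hom.app φ U t = 0
  by_cases hU : Nonempty U
  swap
  · exact eq_of_not_nonempty hU _ _
  obtain ⟨V, e, hV, he⟩ := hM (genericPoint X)
  obtain ⟨V', e', hV', he'⟩ := hN (genericPoint X)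
  have : Nonempty V := ⟨⟨_, hV⟩⟩
  have : Nonempty V' := ⟨⟨_, hV'⟩⟩
  have := nonempty_inf V V'
  have := nonempty_inf (V ⊓ V') U
  let W := V ⊓ V' ⊓ U
  have hWV : W ≤ V := inf_le_left.trans inf_le_left
  have hWV' : W ≤ V' := inf_le_left.trans inf_le_right
  have hWU : W ≤ U := inf_le_right
  obtain ⟨a, ha⟩ := (he.res hWV).exists_smul (res le_top s)
  obtain ⟨b, hb⟩ := (he.res hWV).exists_smul (res hWU t)
  obtain ⟨g, hg⟩ := (he'.res hWV').exists_smul (Scheme.Modules.Hom.app φ W (res hWV e))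
  have ha0 : a ≠ 0 := by
    rintro rfl
    rw [zero_smul] at ha
    exact hs (hM.eq_zero_of_res_eq_zero _ ha)
  have h1 : a * g = 0 := by
    apply (he'.res hWV').smul_left_injective
    rw [zero_smul, mul_smul, ← hg, ← Scheme.Modules.Hom.app_smul, ← ha, app_res, h, res_zero]
  have hg0 : g = 0 := (mul_eq_zero.1 h1).resolve_left ha0
  apply hN.eq_zero_of_res_eq_zero hWU
  rw [← app_res, hb, Scheme.Modules.Hom.app_smul, hg, hg0, zero_smul, smul_zero]

/-- Homomorphisms of line bundles do not decrease the order of vanishing of sections. -/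
theorem IsLineBundle.order_le_order_app [IsLocallyNoetherian X] (hM : IsLineBundle M)
    (hN : IsLineBundle N) (φ : M ⟶ N) {s : Γ(M, ⊤)}
    (h : Scheme.Modules.Hom.app φ ⊤ s ≠ 0) (x : X) :
    order s x ≤ order (Scheme.Modules.Hom.app φ ⊤ s) x := by
  obtain ⟨V, e, hV, he⟩ := hM x
  obtain ⟨V', e', hV', he'⟩ := hN x
  have : Nonempty (V ⊓ V').toScheme := ⟨⟨x, hV, hV'⟩⟩
  have heW := he.res (inf_le_left : V ⊓ V' ≤ V)
  have heW' := he'.res (inf_le_right : V ⊓ V' ≤ V')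
  obtain ⟨a, ha⟩ := heW.exists_smul (res le_top s)
  obtain ⟨g, hg⟩ := heW'.exists_smul
    (Scheme.Modules.Hom.app φ (V ⊓ V') (res inf_le_left e))
  have hag : res le_top (Scheme.Modules.Hom.app φ ⊤ s) =
      (g * a) • res (inf_le_right : V ⊓ V' ≤ V') e' := by
    rw [← app_res, ha, Scheme.Modules.Hom.app_smul, hg, ← mul_smul, mul_comm]
  have hg0 : g ≠ 0 := by
    rintro rfl
    rw [zero_mul, zero_smul] at hag
    exact h (hN.eq_zero_of_res_eq_zero _ hag)
  rw [order_eq_ord he hV _ _ ha, order_eq_ord he' hV' _ _ hag, map_mul]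
  exact Scheme.ord_le_smul (U := V ⊓ V') ⟨hV, hV'⟩ hg0 _

end Hom

/-! ### The homomorphism given by an inequality of divisors -/

section Quotient

variable {X : Scheme.{0}} {M N : X.Modules} {U V W : X.Opens}

/-- Given nowhere vanishing sections `s` of `M` and `t` of `N` over `W`, the graph over `U` of the
homomorphism `M ⟶ N` with a pole allowed outside of `W` which takes `s` to `t`. -/
def Corresponds (s : Γ(M, W)) (t : Γ(N, W)) (m : Γ(M, U)) (n : Γ(N, U)) : Prop :=
  ∃ b : Γ(X, U ⊓ W), res inf_le_left m = b • res inf_le_right s ∧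
    res inf_le_left n = b • res inf_le_right t

section Corresponds

variable {s : Γ(M, W)} {t : Γ(N, W)}

theorem Corresponds.res {m : Γ(M, U)} {n : Γ(N, U)} (h : Corresponds s t m n) (hV : V ≤ U) :
    Corresponds s t (res hV m) (res hV n) := by
  obtain ⟨b, h1, h2⟩ := h
  have hle : V ⊓ W ≤ U ⊓ W := inf_le_inf_right _ hV
  have h1' := congrArg (LineBundle.res hle) h1
  have h2' := congrArg (LineBundle.res hle) h2
  simp only [res_res, res_smul] at h1' h2'
  exact ⟨resFun hle b, by rw [res_res, h1'], by rw [res_res, h2']⟩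

theorem Corresponds.add {m m' : Γ(M, U)} {n n' : Γ(N, U)} (h : Corresponds s t m n)
    (h' : Corresponds s t m' n') : Corresponds s t (m + m') (n + n') := by
  obtain ⟨b, h1, h2⟩ := h
  obtain ⟨b', h1', h2'⟩ := h'
  exact ⟨b + b', by rw [res_add, h1, h1', add_smul], by rw [res_add, h2, h2', add_smul]⟩

theorem Corresponds.smul {m : Γ(M, U)} {n : Γ(N, U)} (h : Corresponds s t m n) (a : Γ(X, U)) :
    Corresponds s t (a • m) (a • n) := by
  obtain ⟨b, h1, h2⟩ := h
  exact ⟨resFun inf_le_left a * b, by rw [res_smul, h1, mul_smul],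
    by rw [res_smul, h2, mul_smul]⟩

variable [IsIntegral X] [Nonempty W]

theorem Corresponds.unique (hN : IsLineBundle N) (hs : IsFrame s) {m : Γ(M, U)} {n n' : Γ(N, U)}
    (h : Corresponds s t m n) (h' : Corresponds s t m n') : n = n' := by
  by_cases hU : Nonempty U
  swap
  · exact eq_of_not_nonempty hU _ _
  obtain ⟨b, h1, h2⟩ := h
  obtain ⟨b', h1', h2'⟩ := h'
  have := nonempty_inf U W
  have hb : b = b' := (hs.res inf_le_right).smul_left_injective (h1.symm.trans h1')
  apply hN.res_injective (inf_le_left : U ⊓ W ≤ U)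
  rw [h2, h2', hb]

/-- If all sections of `M` over small open sets correspond to sections of `N`, then so do all
sections of `M`, by gluing. -/
theorem exists_corresponds (hN : IsLineBundle N) (hs : IsFrame s)
    (hloc : ∀ x : X, ∃ V : X.Opens, x ∈ V ∧ ∀ (U : X.Opens) (_ : U ≤ V) (m : Γ(M, U)),
      ∃ n : Γ(N, U), Corresponds s t m n) (m : Γ(M, U)) :
    ∃ n : Γ(N, U), Corresponds s t m n := by
  choose V hxV hV using hloc
  choose n hn using fun x : X ↦ hV x (U ⊓ V x) inf_le_right (res inf_le_left m)
  obtain ⟨n₀, hn₀⟩ := exists_gluing (fun x ↦ U ⊓ V x) (fun _ ↦ inf_le_left)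
    (fun x hx ↦ ⟨x, hx, hxV x⟩) n fun x y ↦ by
      have h1 := (hn x).res (inf_le_left : (U ⊓ V x) ⊓ (U ⊓ V y) ≤ U ⊓ V x)
      have h2 := (hn y).res (inf_le_right : (U ⊓ V x) ⊓ (U ⊓ V y) ≤ U ⊓ V y)
      rw [res_res] at h1 h2
      exact h1.unique hN hs h2
  refine ⟨n₀, ?_⟩
  obtain ⟨b, hb⟩ := (hs.res (inf_le_right : U ⊓ W ≤ W)).exists_smul (res inf_le_left m)
  refine ⟨b, hb, eq_of_locally_eq _ _ fun x hx ↦ ?_⟩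
  have hle : U ⊓ V x ⊓ W ≤ U ⊓ W := inf_le_inf_right _ inf_le_left
  refine ⟨U ⊓ V x ⊓ W, hle, ⟨⟨hx.1, hxV x⟩, hx.2⟩, ?_⟩
  obtain ⟨b', h1, h2⟩ := hn x
  rw [← hn₀ x, res_res] at h2
  rw [res_res] at h1
  have h3 := congrArg (res hle) hb
  simp only [res_res, res_smul] at h3
  have h4 : b' = resFun hle b := (hs.res _).smul_left_injective (h1.symm.trans h3)
  rw [res_res, h2, res_smul, res_res, h4]

/-- The homomorphism of line bundles with a given graph. -/
theorem exists_hom_of_corresponds (hN : IsLineBundle N) (hs : IsFrame s)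
    (h : ∀ (U : X.Opens) (m : Γ(M, U)), ∃ n : Γ(N, U), Corresponds s t m n) :
    ∃ φ : M ⟶ N, ∀ (U : X.Opens) (m : Γ(M, U)),
      Corresponds s t m (Scheme.Modules.Hom.app φ U m) := by
  choose c hc using h
  let ψ : M.presheaf ⟶ N.presheaf :=
    { app := fun U ↦ AddCommGrpCat.ofHom
        { toFun := c U.unop
          map_zero' := by
            refine (hc _ _).unique hN hs ⟨0, ?_, ?_⟩ <;> rw [zero_smul] <;> exact res_zero _
          map_add' := fun m m' ↦ (hc _ _).unique hN hs ((hc _ m).add (hc _ m')) }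
      naturality := fun U V f ↦ by
        ext m
        exact (hc _ _).unique hN hs ((hc _ m).res (leOfHom f.unop)) }
  refine ⟨⟨PresheafOfModules.homMk ψ fun U r m ↦ ?_⟩, fun U m ↦ hc U m⟩
  exact (hc _ _).unique hN hs ((hc _ m).smul r)

end Corresponds

variable [IsIntegral X] [IsLocallyNoetherian X]

/-- On a nonsingular curve, a function with smaller order of vanishing divides locally. -/
theorem exists_local_dvd {x : X} [IsDiscreteValuationRing (X.presheaf.stalk x)] (hx : x ∈ U)
    [Nonempty U] {a a' : Γ(X, U)} (ha : a ≠ 0) (ha' : a' ≠ 0)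
    (h : Scheme.ord (X.germToFunctionField U a) x ≤ Scheme.ord (X.germToFunctionField U a') x) :
    ∃ (V : X.Opens) (hV : V ≤ U) (c : Γ(X, V)), x ∈ V ∧ resFun hV a' = resFun hV a * c := by
  have hinj := germ_injective_of_isIntegral X x hx
  have hne : ∀ {a : Γ(X, U)}, a ≠ 0 → X.presheaf.germ U x hx a ≠ 0 := fun h ↦
    (map_ne_zero_iff _ hinj).2 h
  rw [Scheme.ord_eq_dvrOrd, Scheme.ord_eq_dvrOrd,
    ← Scheme.algebraMap_germ_eq_germToFunctionField X hx,
    ← Scheme.algebraMap_germ_eq_germToFunctionField X hx,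
    dvrOrd_algebraMap _ (hne ha), dvrOrd_algebraMap _ (hne ha'), Nat.cast_le,
    ← Nat.cast_le (α := ℕ∞),
    ENat.natCast_toNat (Ring.ord_ne_top (mem_nonZeroDivisors_of_ne_zero (hne ha))),
    ENat.natCast_toNat (Ring.ord_ne_top (mem_nonZeroDivisors_of_ne_zero (hne ha'))),
    Ring.ord_eq_addVal, Ring.ord_eq_addVal, IsDiscreteValuationRing.addVal_le_iff_dvd] at h
  obtain ⟨γ, hγ⟩ := h
  obtain ⟨V, hxV, c, rfl⟩ := X.presheaf.exists_germ_eq γ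
  refine ⟨U ⊓ V, inf_le_left, resFun inf_le_right c, ⟨hx, hxV⟩, ?_⟩
  apply germ_injective_of_isIntegral X x (U := U ⊓ V) ⟨hx, hxV⟩
  rw [map_mul]
  erw [X.presheaf.germ_res_apply, X.presheaf.germ_res_apply, X.presheaf.germ_res_apply]
  exact hγ

/-- On a complete nonsingular curve, a section `s'` of a line bundle is the image of a section `s`
of another one if the divisor of `s` is contained in that of `s'`. -/
theorem IsLineBundle.exists_hom [CompactSpace X] (hM : IsLineBundle M) (hN : IsLineBundle N)
    (hX : ∀ x : X, IsClosed ({x} : Set X) → IsDiscreteValuationRing (X.presheaf.stalk x))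
    {s : Γ(M, ⊤)} {s' : Γ(N, ⊤)} (hs : s ≠ 0) (hs' : s' ≠ 0)
    (h : ∀ x, order s x ≤ order s' x) :
    ∃ φ : M ⟶ N, Scheme.Modules.Hom.app φ ⊤ s = s' := by
  -- in terms of frames near `x`, the sections `s` and `s'` are given by nonzero functions
  have hframe : ∀ x : X, ∃ (V : X.Opens) (e : Γ(M, V)) (e' : Γ(N, V)) (a a' : Γ(X, V)),
      x ∈ V ∧ IsFrame e ∧ IsFrame e' ∧ a ≠ 0 ∧ a' ≠ 0 ∧ res le_top s = a • e ∧
        res le_top s' = a' • e' := by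
    intro x
    obtain ⟨V, e, hV, he⟩ := hM x
    obtain ⟨V', e', hV', he'⟩ := hN x
    have : Nonempty (V ⊓ V').toScheme := ⟨⟨x, hV, hV'⟩⟩
    have he1 := he.res (inf_le_left : V ⊓ V' ≤ V)
    have he1' := he'.res (inf_le_right : V ⊓ V' ≤ V')
    obtain ⟨a, ha⟩ := he1.exists_smul (res le_top s)
    obtain ⟨a', ha'⟩ := he1'.exists_smul (res le_top s')
    refine ⟨V ⊓ V', _, _, a, a', ⟨hV, hV'⟩, he1, he1', ?_, ?_, ha, ha'⟩
    · rintro rfl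
      rw [zero_smul] at ha
      exact hs (hM.eq_zero_of_res_eq_zero _ ha)
    · rintro rfl
      rw [zero_smul] at ha'
      exact hs' (hN.eq_zero_of_res_eq_zero _ ha')
  -- the open set where neither `s` nor `s'` vanishes
  obtain ⟨W, hWne, hsW, hsW'⟩ : ∃ W : X.Opens, Nonempty W ∧
      IsFrame (res (le_top : W ≤ ⊤) s) ∧ IsFrame (res (le_top : W ≤ ⊤) s') := by
    obtain ⟨V, e, e', a, a', hV, he, he', ha, ha', hae, hae'⟩ := hframe (genericPoint X)
    let W := X.basicOpen (a * a')
    have hW : W ≤ V := X.basicOpen_le _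
    have : Nonempty V := ⟨⟨_, hV⟩⟩
    have hu : IsUnit (resFun hW (a * a')) := X.toRingedSpace.isUnit_res_basicOpen _
    rw [resFun_mul, IsUnit.mul_iff] at hu
    have hae1 := congrArg (res hW) hae
    have hae1' := congrArg (res hW) hae'
    simp only [res_res, res_smul] at hae1 hae1'
    refine ⟨W, ⟨⟨genericPoint X, ?_⟩⟩, hae1 ▸ (he.res hW).smul hu.1,
      hae1' ▸ (he'.res hW).smul hu.2⟩
    rw [Scheme.mem_basicOpen X _ _ hV, isUnit_iff_ne_zero]
    exact (map_ne_zero_iff _ (germ_injective_of_isIntegral X _ hV)).2 (mul_ne_zero ha ha')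
  -- the homomorphism `s' / s` is regular if it is so locally
  suffices hloc : ∀ y : X, ∃ V : X.Opens, y ∈ V ∧ ∀ (U : X.Opens) (_ : U ≤ V) (m : Γ(M, U)),
      ∃ n : Γ(N, U), Corresponds (res (le_top : W ≤ ⊤) s) (res (le_top : W ≤ ⊤) s') m n by
    obtain ⟨φ, hφ⟩ := exists_hom_of_corresponds hN hsW
      fun U m ↦ exists_corresponds hN hsW hloc m
    refine ⟨φ, (hφ ⊤ s).unique hN hsW ⟨1, ?_, ?_⟩⟩ <;> rw [one_smul, res_res]
  intro y
  -- a neighbourhood of a closed specialization `x` of `y` is one of `y`, and `a` divides `a'` there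
  obtain ⟨x, hx, hyx⟩ := Scheme.exists_isClosed_specializes y
  have := hX x hx
  obtain ⟨V, e, e', a, a', hV, he, he', ha, ha', hae, hae'⟩ := hframe x
  have : Nonempty V := ⟨⟨_, hV⟩⟩
  have hord := h x
  rw [order_eq_ord he hV (W := V) le_top le_rfl (a := a) (by rw [hae, res_self]),
    order_eq_ord he' hV (W := V) le_top le_rfl (a := a') (by rw [hae', res_self])] at hord
  obtain ⟨V₁, hV₁, c, hxV₁, hc⟩ := exists_local_dvd hV ha ha' hord
  refine ⟨V₁, hyx.mem_open V₁.isOpen hxV₁, fun U hU m ↦ ?_⟩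
  obtain ⟨b, rfl⟩ := (he.res (hU.trans hV₁)).exists_smul m
  obtain ⟨β, hβ⟩ := (hsW.res (inf_le_right : U ⊓ W ≤ W)).exists_smul
    (res inf_le_left (b • res (hU.trans hV₁) e))
  refine ⟨(b * resFun hU c) • res (hU.trans hV₁) e', β, hβ, ?_⟩
  have hle : U ⊓ W ≤ V := inf_le_left.trans (hU.trans hV₁)
  have hae1 := congrArg (res hle) hae
  have hae1' := congrArg (res hle) hae'
  have hc1 := congrArg (resFun (inf_le_left.trans hU : U ⊓ W ≤ V₁)) hc
  simp only [res_res, res_smul, resFun_mul, resFun_resFun] at hae1 hae1' hβ hc1 ⊢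
  rw [hae1, ← mul_smul] at hβ
  have hb := (he.res _).smul_left_injective hβ
  rw [hae1', ← mul_smul, hb, hc1, mul_assoc]

end Quotient

/-! ### The annihilator of a section of a direct sum -/

section Additive

variable {X : Scheme.{0}} {M : X.Modules}

theorem app_comp {M₁ M₂ M₃ : X.Modules} (φ : M₁ ⟶ M₂) (ψ : M₂ ⟶ M₃) {U : X.Opens}
    (m : Γ(M₁, U)) : Scheme.Modules.Hom.app (φ ≫ ψ) U m =
      Scheme.Modules.Hom.app ψ U (Scheme.Modules.Hom.app φ U m) := by
  simp

theorem app_add {M₁ M₂ : X.Modules} (φ ψ : M₁ ⟶ M₂) {U : X.Opens} (m : Γ(M₁, U)) :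
    Scheme.Modules.Hom.app (φ + ψ) U m =
      Scheme.Modules.Hom.app φ U m + Scheme.Modules.Hom.app ψ U m := by
  simp

theorem app_neg {M₁ M₂ : X.Modules} (φ : M₁ ⟶ M₂) {U : X.Opens} (m : Γ(M₁, U)) :
    Scheme.Modules.Hom.app (-φ) U m = - Scheme.Modules.Hom.app φ U m := by
  rw [eq_neg_iff_add_eq_zero, ← app_add, neg_add_cancel]
  rfl

/-- A module sheaf whose identity is zero has no nonzero sections, hence degree zero. -/
theorem degree_eq_zero_of_id_eq_zero [IsIntegral X] [IsLocallyNoetherian X] (h : 𝟙 M = 0) :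
    degree M = 0 := by
  rw [degree, dif_neg]
  rintro ⟨⟨U, m⟩, hm⟩
  apply hm
  change m = 0
  have : Scheme.Modules.Hom.app (𝟙 M) U m = Scheme.Modules.Hom.app (0 : M ⟶ M) U m := by rw [h]
  simpa using this

end Additive

end LineBundle

theorem mem_sectionAnnihilator {X : Scheme.{0}} {ℰ : X.Modules} {σ : Γ(ℰ, ⊤)} {φ : ℰ ⟶ ℰ} :
    φ ∈ sectionAnnihilator σ ↔ Scheme.Modules.Hom.app φ ⊤ σ = 0 :=
  Iff.rfl

section Matrix

open LineBundle

variable {X : Scheme.{0}} {N N' ℰ : X.Modules} (i : ℰ ≅ N ⊞ N')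
  {σ : Γ(ℰ, ⊤)} {s : Γ(N, ⊤)} {s' : Γ(N', ⊤)}
  (hs : s = Scheme.Modules.Hom.app (i.hom ≫ biprod.fst) ⊤ σ)
  (hs' : s' = Scheme.Modules.Hom.app (i.hom ≫ biprod.snd) ⊤ σ)

include hs hs'

/-- The image of `σ` in terms of its components. -/
theorem app_iso_hom_comp {P : X.Modules} (φ : N ⊞ N' ⟶ P) :
    Scheme.Modules.Hom.app (i.hom ≫ φ) ⊤ σ =
      Scheme.Modules.Hom.app (biprod.inl ≫ φ) ⊤ s +
        Scheme.Modules.Hom.app (biprod.inr ≫ φ) ⊤ s' := by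
  rw [hs, hs', ← app_comp, ← app_comp, ← app_add, Category.assoc, Category.assoc,
    ← Preadditive.comp_add, ← Category.assoc biprod.fst, ← Category.assoc biprod.snd,
    ← Preadditive.add_comp, biprod.total, Category.id_comp]

/-- The rows of the matrix of an endomorphism which kills `σ` are relations between the components
of `σ`. -/
theorem sectionAnnihilator_eq_bot_of_hom
    (h : ∀ (P : X.Modules), P = N ∨ P = N' → ∀ (a : N ⟶ P) (b : N' ⟶ P),
      Scheme.Modules.Hom.app a ⊤ s + Scheme.Modules.Hom.app b ⊤ s' = 0 → a = 0 ∧ b = 0) :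
    sectionAnnihilator σ = ⊥ := by
  rw [eq_bot_iff]
  intro φ (hφ : Scheme.Modules.Hom.app φ ⊤ σ = 0)
  change φ = (0 : ℰ ⟶ ℰ)
  have key : ∀ (P : X.Modules), P = N ∨ P = N' → ∀ p : N ⊞ N' ⟶ P,
      i.inv ≫ φ ≫ i.hom ≫ p = 0 := by
    intro P hP p
    obtain ⟨h1, h2⟩ := h P hP (biprod.inl ≫ i.inv ≫ φ ≫ i.hom ≫ p)
      (biprod.inr ≫ i.inv ≫ φ ≫ i.hom ≫ p) (by
        rw [← app_iso_hom_comp i hs hs', i.hom_inv_id_assoc, app_comp, hφ, map_zero])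
    apply biprod.hom_ext'
    · rw [h1, comp_zero]
    · rw [h2, comp_zero]
  have h1 : i.inv ≫ φ ≫ i.hom = 0 := by
    apply biprod.hom_ext
    · simpa only [Category.assoc, zero_comp] using key N (Or.inl rfl) biprod.fst
    · simpa only [Category.assoc, zero_comp] using key N' (Or.inr rfl) biprod.snd
  rwa [Preadditive.IsIso.comp_left_eq_zero, Preadditive.IsIso.comp_right_eq_zero] at h1

/-- A relation between the components of `σ` with values in a subsheaf of `N ⊞ N'` gives an
endomorphism which kills `σ`. -/
theorem hom_eq_zero_of_sectionAnnihilator_eq_bot (h : sectionAnnihilator σ = ⊥) {P : X.Modules}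
    (a : N ⟶ P) (b : N' ⟶ P) (j : P ⟶ N ⊞ N') [Mono j]
    (hab : Scheme.Modules.Hom.app a ⊤ s + Scheme.Modules.Hom.app b ⊤ s' = 0) :
    a = 0 ∧ b = 0 := by
  have hmem : i.hom ≫ biprod.desc a b ≫ j ≫ i.inv ∈ sectionAnnihilator σ := by
    rw [mem_sectionAnnihilator, ← Category.assoc, app_comp, app_iso_hom_comp i hs hs',
      biprod.inl_desc, biprod.inr_desc, hab, map_zero]
  rw [h] at hmem
  have h0 : i.hom ≫ biprod.desc a b ≫ j ≫ i.inv = 0 := hmem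
  rw [Preadditive.IsIso.comp_left_eq_zero] at h0
  have h1 := zero_of_comp_mono _ h0
  exact ⟨by rw [← biprod.inl_desc a b, h1, comp_zero], by rw [← biprod.inr_desc a b, h1, comp_zero]⟩

end Matrix

theorem mainTheorem12 (E : Over (Spec (.of ℂ))) [IsComplexEllipticCurve E]
    (N N' ℰ : E.left.Modules)
    (hN : LineBundle.IsLineBundle N) (hN' : LineBundle.IsLineBundle N')
    (hd : 2 ≤ LineBundle.degree N) (hdd' : LineBundle.degree N ≤ LineBundle.degree N')
    (i : ℰ ≅ N ⊞ N') (σ : Γ(ℰ, ⊤)) (s : Γ(N, ⊤)) (s' : Γ(N', ⊤))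
    (hs : s = Scheme.Modules.Hom.app (i.hom ≫ biprod.fst) ⊤ σ)
    (hs' : s' = Scheme.Modules.Hom.app (i.hom ≫ biprod.snd) ⊤ σ) :
    sectionAnnihilator σ = ⊥ ↔
      s ≠ 0 ∧ s' ≠ 0 ∧ ¬ LineBundle.zeroDivisor s ≤ LineBundle.zeroDivisor s' := by
  have hX := IsComplexEllipticCurve.isDiscreteValuationRing (E := E)
  have : IsProper E.hom := IsComplexEllipticCurve.isProper
  have : CompactSpace E.left := (quasiCompact_iff_compactSpace (f := E.hom)).1 inferInstance
  have hN0 : 𝟙 N ≠ 0 := fun h ↦ by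
    have := LineBundle.degree_eq_zero_of_id_eq_zero h
    lia
  have hN'0 : 𝟙 N' ≠ 0 := fun h ↦ by
    have := LineBundle.degree_eq_zero_of_id_eq_zero h
    lia
  constructor
  · intro h
    have hs0 : s ≠ 0 := fun h0 ↦ hN0
      (hom_eq_zero_of_sectionAnnihilator_eq_bot i hs hs' h (𝟙 N) 0 biprod.inl (by simp [h0])).1
    have hs'0 : s' ≠ 0 := fun h0 ↦ hN'0
      (hom_eq_zero_of_sectionAnnihilator_eq_bot i hs hs' h 0 (𝟙 N') biprod.inr (by simp [h0])).2
    refine ⟨hs0, hs'0, fun hle ↦ ?_⟩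
    -- `(c, -1)` with `c = s' / s` is a nontrivial relation with values in `N'`
    obtain ⟨c, hc⟩ := hN.exists_hom hN' hX hs0 hs'0 hle
    exact hN'0 (neg_eq_zero.1 (hom_eq_zero_of_sectionAnnihilator_eq_bot i hs hs' h c (-𝟙 N')
      biprod.inr (by simp [hc, LineBundle.app_neg])).2)
  · rintro ⟨hs0, hs'0, hle⟩
    refine sectionAnnihilator_eq_bot_of_hom i hs hs' ?_
    rintro P (rfl | rfl) a b hab
    · have ha : a = 0 := by
        by_contra ha
        have ha0 : Scheme.Modules.Hom.app a ⊤ s ≠ 0 := fun h ↦ ha (hN.hom_eq_zero hN a hs0 h)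
        have h1 : Scheme.Modules.Hom.app (-b) ⊤ s' = Scheme.Modules.Hom.app a ⊤ s := by
          rw [LineBundle.app_neg, neg_eq_iff_add_eq_zero, add_comm, hab]
        have h2 := hN'.order_le_order_app hN (-b) (h1 ▸ ha0)
        rw [h1] at h2
        -- `a s = -b s'` has the divisor of `s` and that of `s'`
        have h3 := hN.order_eq_of_le E.hom hX hN le_rfl hs0 ha0 (hN.order_le_order_app hN a ha0)
        have h4 := hN'.order_eq_of_le E.hom hX hN hdd' hs'0 ha0 h2
        exact hle fun x ↦ ((h3 x).trans (h4 x).symm).le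
      subst ha
      refine ⟨rfl, hN'.hom_eq_zero hN b hs'0 ?_⟩
      simpa using hab
    · have hb : b = 0 := by
        by_contra hb
        have hb0 : Scheme.Modules.Hom.app b ⊤ s' ≠ 0 := fun h ↦ hb (hN'.hom_eq_zero hN' b hs'0 h)
        have h1 : Scheme.Modules.Hom.app (-a) ⊤ s = Scheme.Modules.Hom.app b ⊤ s' := by
          rw [LineBundle.app_neg, neg_eq_iff_add_eq_zero, hab]
        have h2 := hN.order_le_order_app hN' (-a) (h1 ▸ hb0)
        rw [h1] at h2
        -- `b s' = -a s` has the divisor of `s'`, and at least that of `s`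
        have h3 := hN'.order_eq_of_le E.hom hX hN' le_rfl hs'0 hb0
          (hN'.order_le_order_app hN' b hb0)
        exact hle fun x ↦ (h2 x).trans (h3 x).symm.le
      subst hb
      refine ⟨hN.hom_eq_zero hN' a hs0 ?_, rfl⟩
      simpa using hab
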